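/- Let $K$ be a field. Let $\mathbf{GrAlg}$ be the category of connected $\mathbb N$-graded associative unital $K$-algebras $A=\bigoplus_{n\ge 0}A_n$ ($A_0=K\cdot 1\ne 0$) which are finitely generated in degree $1$ and finitely presented with homogeneous relations of degrees $\ge 2$ (that is, $A=T(A_1)/[R]$ with $A_1$ finite-dimensional and $R$ a finite set of homogeneous elements of degrees $\ge 2$, $[R]$ denoting the two-sided ideal generated by $R$), with the degree-$0$ homogeneous algebra homomorphisms as morphisms. Regard $K$ as a left and a right $A$-module through the augmentation $A\to A_0=K$. An algebra $A\in\mathbf{GrAlg}$ is called regular of global dimension $D\in\mathbb N$ if its global dimension (the supremum of the projective dimensions of its left modules) equals $D$ and $A$ is Gorenstein: $\mathrm{Ext}^n_A(K,A)=0$ for $n\neq D$ and $\mathrm{Ext}^D_A(K,A)\cong K$ as right $A$-modules. **Theorem.** 1. Let $g\ge 2$ and let $b$ be a nondegenerate bilinear form on $K^g$ with components $B_{\mu\nu}=b(e_\mu,e_\nu)$ in the canonical basis. Then the quadratic algebra $$\mathcal A(b)=K\langle x^1,\dots,x^g\rangle\Big/\Big[\sum_{\mu,\nu}B_{\mu\nu}x^\mu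 x^\nu\Big],$$ graded by $\deg x^\mu=1$, is regular of global dimension $2$. 2. Conversely, every regular algebra of global dimension $2$ is isomorphic in $\mathbf{GrAlg}$ to $\mathcal A(b)$ for some $g\ge 2$ and some nondegenerate bilinear form $b$ on $K^g$. 3. Let $g,g'\ge 2$ and let $b$, $b'$ be nondegenerate bilinear forms on $K^g$ and $K^{g'}$. Then $\mathcal A(b)$ and $\mathcal A(b')$ are isomorphic in $\mathbf{GrAlg}$ if and only if $g=g'$ and $b'=c\,(b\circ L)$ for some $L\in GL(g,K)$ and some nonzero scalar $c\in K$, where $(b\circ L)(v,w)=b(Lv,Lw)$. If every element of $K$ is a square in $K$ (for example, if $K$ is algebraically closed), this holds if and only if $g=g'$ and $b'=b\circ L$ for some $L\in GL(g,K)$. -/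

import Mathlib

open CategoryTheory CategoryTheory.Abelian
open scoped DirectSum

universe u

noncomputable section

/-! ### Connected graded algebras: finitely generated in degree 1, finitely presented -/

section GradedAlgebras

variable {K : Type u} [Field K] {A : Type u} [Ring A] [Algebra K A]

/-- The graded algebra `A = ⨁ₙ 𝒜 n` is connected: `A₀ = K · 1` (and `1 ≠ 0`). -/
class IsConnectedGraded (𝒜 : ℕ → Submodule K A) [GradedAlgebra 𝒜] : Prop where
  bijective_algebraMap : Function.Bijective (algebraMap K (𝒜 0))

/-- The canonical algebra homomorphism `T(𝒜 1) → A` from the tensor algebra of the degree-1 part. -/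
def tensorToAlg (𝒜 : ℕ → Submodule K A) : TensorAlgebra K (𝒜 1) →ₐ[K] A :=
  TensorAlgebra.lift K (𝒜 1).subtype

/-- Objects of the category `GrAlg`: connected `ℕ`-graded algebras, finitely generated in degree 1
and finitely presented with homogeneous relations of degrees `≥ 2`, that is `A = T(E)/[R]` with
`E = A₁` finite-dimensional and `[R]` the two-sided ideal generated by finitely many
homogeneous elements of degrees `≥ 2`. -/
structure IsGrAlg (𝒜 : ℕ → Submodule K A) [GradedAlgebra 𝒜] : Prop where
  connected : IsConnectedGraded 𝒜
  finite_degree_one : Module.Finite K (𝒜 1)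
  generated : Function.Surjective (tensorToAlg 𝒜)
  presented : ∃ R : Finset (TensorAlgebra K (𝒜 1)),
    (∀ f ∈ R, ∃ n : ℕ, 2 ≤ n ∧
      f ∈ LinearMap.range (TensorAlgebra.ι K : 𝒜 1 →ₗ[K] TensorAlgebra K (𝒜 1)) ^ n) ∧
    TwoSidedIdeal.span (R : Set (TensorAlgebra K (𝒜 1))) = TwoSidedIdeal.ker (tensorToAlg 𝒜)

/-- Isomorphism in `GrAlg`: an isomorphism of algebras that is homogeneous of degree 0. -/
def GradedIso {B : Type u} [Ring B] [Algebra K B]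
    (𝒜 : ℕ → Submodule K A) (ℬ : ℕ → Submodule K B) : Prop :=
  ∃ e : A ≃ₐ[K] B, ∀ n : ℕ, (𝒜 n).map e.toLinearMap = ℬ n

/-! ### The trivial module, global dimension and the Gorenstein property -/

/-- The augmentation `ε : A → A₀ = K` of a connected graded algebra. -/
def augmentation (𝒜 : ℕ → Submodule K A) [GradedAlgebra 𝒜] [IsConnectedGraded 𝒜] : A →+* K :=
  (RingEquiv.ofBijective (algebraMap K (𝒜 0))
    IsConnectedGraded.bijective_algebraMap).symm.toRingHom.comp (GradedRing.projZeroRingHom' 𝒜)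

/-- The left `A`-module `K`, on which `A` acts through the augmentation. -/
def trivialModule (𝒜 : ℕ → Submodule K A) [GradedAlgebra 𝒜] [IsConnectedGraded 𝒜] :
    ModuleCat.{u} A :=
  (ModuleCat.restrictScalars (augmentation 𝒜)).obj (ModuleCat.of K K)

/-- The (left) global dimension of a ring: the supremum of the projective dimensions of all its
left modules. -/
def globalDimension (A : Type u) [Ring A] : WithBot ℕ∞ :=
  ⨆ M : ModuleCat.{u} A, projectiveDimension M

/-- Right multiplication by `a`, as an endomorphism of the left module `A`. -/
def rightMul (a : A) : ModuleCat.of A A ⟶ ModuleCat.of A A :=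
  ModuleCat.ofHom (LinearMap.toSpanSingleton A A a)

/-- The right action of `A` on `Extⁿ_A(M, A)`, induced by the right multiplication of `A` on the
left module `A`. -/
def extRightAction {M : ModuleCat.{u} A} {n : ℕ} (ξ : Ext M (ModuleCat.of A A) n) (a : A) :
    Ext M (ModuleCat.of A A) n :=
  ξ.comp (Ext.mk₀ (rightMul a)) (add_zero n)

/-- The Gorenstein property in dimension `D`: `Extⁿ_A(K, A) = 0` for `n ≠ D`, and
`Ext^D_A(K, A) ≅ K` as right `A`-modules. -/
structure IsGorenstein (𝒜 : ℕ → Submodule K A) [GradedAlgebra 𝒜] [IsConnectedGraded 𝒜]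
    (D : ℕ) : Prop where
  ext_eq_zero : ∀ n : ℕ, n ≠ D → Subsingleton (Ext (trivialModule 𝒜) (ModuleCat.of A A) n)
  ext_top : ∃ e : Ext (trivialModule 𝒜) (ModuleCat.of A A) D ≃+ K,
    ∀ ξ a, e (extRightAction ξ a) = e ξ * augmentation 𝒜 a

/-- `A` is a regular algebra of global dimension `D`: it belongs to `GrAlg`, has
(finite) global dimension `D` and is Gorenstein. -/
structure IsRegularOfDim (𝒜 : ℕ → Submodule K A) [GradedAlgebra 𝒜] (D : ℕ) : Prop where
  grAlg : IsGrAlg 𝒜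
  globalDimension_eq : globalDimension A = D
  gorenstein : haveI := grAlg.connected; IsGorenstein 𝒜 D

end GradedAlgebras

/-! ### The quadratic algebra of a bilinear form -/

namespace QuadAlg

variable {K : Type u} [Field K] {g : ℕ}

/-- The components `b(e_μ, e_ν)` in the canonical basis of `K^g`. -/
def comp (b : LinearMap.BilinForm K (Fin g → K)) (μ ν : Fin g) : K :=
  b (Pi.single μ 1) (Pi.single ν 1)

/-- The element `∑ b(e_μ, e_ν) x^μ x^ν` of the free algebra `K⟨x^1, …, x^g⟩`. -/
def relator (b : LinearMap.BilinForm K (Fin g → K)) : FreeAlgebra K (Fin g) :=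
  ∑ μ, ∑ ν, comp b μ ν • (FreeAlgebra.ι K μ * FreeAlgebra.ι K ν)

/-- The single relation `∑ b(e_μ, e_ν) x^μ x^ν = 0`. -/
inductive Rel (b : LinearMap.BilinForm K (Fin g → K)) :
    FreeAlgebra K (Fin g) → FreeAlgebra K (Fin g) → Prop
  | of : Rel b (relator b) 0

end QuadAlg

/-- The quadratic algebra `K⟨x^1, …, x^g⟩ / [∑ b(e_μ, e_ν) x^μ x^ν]`. -/
abbrev QuadAlg {K : Type u} [Field K] {g : ℕ} (b : LinearMap.BilinForm K (Fin g → K)) : Type u :=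
  RingQuot (QuadAlg.Rel b)

namespace QuadAlg

variable {K : Type u} [Field K] {g : ℕ} (b : LinearMap.BilinForm K (Fin g → K))

/-- The generators `x^μ`. -/
def gen (μ : Fin g) : QuadAlg b := RingQuot.mkAlgHom K (Rel b) (FreeAlgebra.ι K μ)

/-- The degree-`n` part: the span of the products of `n` generators. -/
def grading (n : ℕ) : Submodule K (QuadAlg b) := Submodule.span K (Set.range (gen b)) ^ n

instance : SetLike.GradedMonoid (grading b) where
  one_mem := by
    change (1 : QuadAlg b) ∈ Submodule.span K (Set.range (gen b)) ^ 0
    rw [pow_zero]; exact Submodule.one_le.mp le_rfl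
  mul_mem i j x y hx hy := by
    change x * y ∈ Submodule.span K (Set.range (gen b)) ^ (i + j)
    rw [pow_add]; exact Submodule.mul_mem_mul hx hy

theorem gen_mem (μ : Fin g) : gen b μ ∈ grading b 1 := by
  change gen b μ ∈ Submodule.span K (Set.range (gen b)) ^ 1
  rw [pow_one]; exact Submodule.subset_span ⟨μ, rfl⟩

theorem relation :
    ∑ μ, ∑ ν, comp b μ ν • (gen b μ * gen b ν) = 0 := by
  have h := RingQuot.mkAlgHom_rel K (Rel.of (b := b))
  simpa [relator, gen] using h

/-- The decomposition of the algebra into its homogeneous parts. -/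
def decomposeHom : QuadAlg b →ₐ[K] ⨁ n, grading b n :=
  RingQuot.liftAlgHom K ⟨FreeAlgebra.lift K fun μ =>
    DirectSum.of (fun n => grading b n) 1 ⟨gen b μ, gen_mem b μ⟩, by
      rintro _ _ ⟨⟩
      have key : ∀ μ ν : Fin g,
          (DirectSum.of (fun n => grading b n) 1 ⟨gen b μ, gen_mem b μ⟩ *
            DirectSum.of (fun n => grading b n) 1 ⟨gen b ν, gen_mem b ν⟩) =
          DirectSum.lof K ℕ (fun n => grading b n) 2
            ⟨gen b μ * gen b ν, SetLike.mul_mem_graded (gen_mem b μ) (gen_mem b ν)⟩ := by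
        intro μ ν
        rw [DirectSum.of_mul_of]; rfl
      have hsum : ∀ s : Fin g → Fin g → grading b 2,
          ∑ μ, ∑ ν, comp b μ ν • DirectSum.lof K ℕ (fun n => grading b n) 2 (s μ ν) =
            DirectSum.lof K ℕ (fun n => grading b n) 2 (∑ μ, ∑ ν, comp b μ ν • s μ ν) := by
        intro s; simp only [map_sum, map_smul]
      simp only [relator, map_sum, map_smul, map_mul, FreeAlgebra.lift_ι_apply, map_zero, key]
      refine (hsum _).trans
        ((congrArg _ (?_ : _ = (0 : grading b 2))).trans (LinearMap.map_zero _))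
      apply Subtype.ext
      simpa using relation b⟩

theorem decomposeHom_gen (μ : Fin g) : decomposeHom b (gen b μ) =
    DirectSum.of (fun n => grading b n) 1 ⟨gen b μ, gen_mem b μ⟩ := by
  simp [decomposeHom, gen]

instance gradedAlgebra : GradedAlgebra (grading b) :=
  GradedAlgebra.ofAlgHom _ (decomposeHom b)
    (by
      apply RingQuot.ringQuot_ext'
      apply FreeAlgebra.hom_ext
      funext μ
      change DirectSum.coeAlgHom (grading b) (decomposeHom b (gen b μ)) = gen b μ
      rw [decomposeHom_gen, DirectSum.coeAlgHom_of])
    (by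
      rintro i ⟨x, hx⟩
      change x ∈ Submodule.span K (Set.range (gen b)) ^ i at hx
      change decomposeHom b x = DirectSum.lof K ℕ (fun n => grading b n) i ⟨x, hx⟩
      induction hx using Submodule.pow_induction_on_left' with
      | algebraMap r => rw [AlgHom.commutes, DirectSum.algebraMap_apply]; rfl
      | add x y i hx hy ihx ihy => rw [map_add, ihx, ihy, ← map_add]; rfl
      | mem_mul m hm i x hx ih =>
        rw [map_mul, ih]
        have hm' : m ∈ grading b 1 := by
          change m ∈ Submodule.span K (Set.range (gen b)) ^ 1
          rwa [pow_one]
        have h1 : decomposeHom b m = DirectSum.lof K ℕ (fun n => grading b n) 1 ⟨m, hm'⟩ := by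
          clear ih hx
          induction hm using Submodule.span_induction with
          | mem y hy => obtain ⟨μ, rfl⟩ := hy; exact decomposeHom_gen b μ
          | zero => rw [map_zero]; exact (map_zero _).symm
          | add y z hy hz ihy ihz =>
            have hy' : y ∈ grading b 1 := by
              change y ∈ Submodule.span K (Set.range (gen b)) ^ 1
              rwa [pow_one]
            have hz' : z ∈ grading b 1 := by
              change z ∈ Submodule.span K (Set.range (gen b)) ^ 1
              rwa [pow_one]
            rw [map_add, ihy hy', ihz hz', ← map_add]; rfl
          | smul c y hy ihy =>
            have hy' : y ∈ grading b 1 := by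
              change y ∈ Submodule.span K (Set.range (gen b)) ^ 1
              rwa [pow_one]
            rw [map_smul, ihy hy', ← map_smul]; rfl
        rw [h1, DirectSum.lof_eq_of, DirectSum.lof_eq_of, DirectSum.of_mul_of]
        exact DirectSum.of_eq_of_gradedMonoid_eq (Sigma.subtype_ext (add_comm _ _) rfl))

end QuadAlg

end

/-! Write $f_\nu=\sum_\mu B_{\mu\nu}x^\mu$, so that the relation of $A=\mathcal A(b)$ reads
$\sum_\nu f_\nu x^\nu=0$. Everything rests on the complex $0\to A\to A^g\to A\to K\to 0$ with maps
$t\mapsto(tf_\nu)_\nu$ and $v\mapsto\sum v_\nu x^\nu$.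

Regularity of $\mathcal A(b)$. Since the algebra has one explicit relation, linear maps on it can be
defined by recursion along multiplication by generators (`exists_linearMap_mul_gen`). Applied to the
map "class of the coefficient vector modulo multiples of $f$", this gives exactness at $A^g$
(`exists_eq_mul_leftPart`). Nondegeneracy and $g\ge 2$ make multiplication by a nonzero linear form
injective (`eq_zero_of_mul_linear`), which gives exactness on the left. The same recursion resolves
every module $M$ by $0\to A\otimes_K M\to(A\otimes_K M)^g\to A\otimes_K M\to M\to 0$
(`range_koszulTwo`, `koszulTwo_injective`), so the global dimension is at most 2. As $B$ is
invertible, applying $\mathrm{Hom}_A(-,A)$ to the resolution of $K$ yields a complex of right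
modules of the same shape; this is the Gorenstein property, and $\mathrm{Ext}^2\cong K\ne 0$ makes
the dimension exactly 2.

Converse. Let $x$ be a basis of $A_1$ and $\Omega=\ker(A^g\to A)$ its module of syzygies. Global
dimension 2 makes $\Omega$ projective, and the Gorenstein property says that
$\mathrm{Hom}(\Omega,A)$ modulo restrictions from $A^g$ is $K$. Restrictions send $\Omega$ into
$A_+$, so modulo $A_+$ all functionals on $\Omega$ are multiples of a single one; a dual basis and
Nakayama show that $\Omega$ is generated by one homogeneous $f$, and vanishing of the action of
$A_1$ on $\mathrm{Ext}^2$ forces $f$ to consist of linear forms spanning $A_1$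
(`exists_generator_of_projective`). Its coefficient matrix is the form $b$, and $\mathcal A(b)\to A$
is an isomorphism by induction on the degree (`gradedIso_of_generator`).

Classification. The quadratic relations of $\mathcal A(b')$ form the line spanned by $b'$
(`exists_eq_mul_comp`), so a graded isomorphism is a linear substitution carrying $b$ to a multiple
of $b'$. -/

noncomputable section

/-! ### Ext into the regular module from a presentation by free modules. -/

section Homological

variable {A : Type u} [Ring A] {N : Type u} [AddCommGroup N] [Module A N] {g : ℕ}

/-- The short complex `ker f → M → P` of a linear map `f : M → P`. -/
abbrev kernelComplex {M P : Type u} [AddCommGroup M] [Module A M] [AddCommGroup P] [Module A P]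
    (f : M →ₗ[A] P) : ShortComplex (ModuleCat.{u} A) :=
  ShortComplex.mk (ModuleCat.ofHom (LinearMap.ker f).subtype) (ModuleCat.ofHom f) (by
    ext x; exact x.2)

theorem kernelComplex_shortExact {M P : Type u} [AddCommGroup M] [Module A M] [AddCommGroup P]
    [Module A P] (f : M →ₗ[A] P) (hf : Function.Surjective f) :
    (kernelComplex f).ShortExact :=
  ModuleCat.shortComplex_shortExact _ (LinearMap.exact_subtype_ker_map f)
    (Submodule.injective_subtype _) hf

theorem subsingleton_ext_zero (h : ∀ f : N →ₗ[A] A, f = 0) :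
    Subsingleton (Ext (ModuleCat.of A N) (ModuleCat.of A A) 0) := by
  refine (Ext.addEquiv₀ (X := ModuleCat.of A N) (Y := ModuleCat.of A A)).toEquiv.subsingleton_congr.2
    ⟨fun f f' => ?_⟩
  ext1
  rw [h f.hom, h f'.hom]

theorem linearMap_eq_zero_of_subsingleton_ext_zero
    (h : Subsingleton (Ext (ModuleCat.of A N) (ModuleCat.of A A) 0)) (f : N →ₗ[A] A) : f = 0 := by
  have := (Ext.addEquiv₀ (X := ModuleCat.of A N)
    (Y := ModuleCat.of A A)).toEquiv.subsingleton_congr.1 h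
  exact congrArg ModuleCat.Hom.hom (this.elim (ModuleCat.ofHom f) 0)

/-- Dimension shift: $\mathrm{Ext}^1(A,-)=0$, so every class is the connecting image of a functional
on $\ker\varepsilon$, and functionals extending to $A$ have zero image. -/
theorem subsingleton_ext_one (ε : A →ₗ[A] N) (hε : Function.Surjective ε)
    (h : ∀ φ : LinearMap.ker ε →ₗ[A] A, ∃ ψ : A →ₗ[A] A, φ = ψ ∘ₗ (LinearMap.ker ε).subtype) :
    Subsingleton (Ext (ModuleCat.of A N) (ModuleCat.of A A) 1) := by
  have hS := kernelComplex_shortExact ε hε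
  refine subsingleton_of_forall_eq 0 fun ξ => ?_
  have : Projective (kernelComplex ε).X₂ :=
    (IsProjective.iff_projective A).1 inferInstance
  obtain ⟨x₁, rfl⟩ := Ext.contravariant_sequence_exact₃ hS _ ξ
    (Ext.eq_zero_of_hasProjectiveDimensionLT _ 1 le_rfl) (n₀ := 0) rfl
  obtain ⟨φ, rfl⟩ := (Ext.mk₀_bijective _ _).2 x₁
  obtain ⟨ψ, hψ⟩ := h φ.hom
  have : φ = (kernelComplex ε).f ≫ ModuleCat.ofHom ψ := by ext1; exact hψ
  rw [this, ← Ext.mk₀_comp_mk₀]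
  exact hS.extClass_comp_assoc _

/-- `Ext²(N, A)` computed from a partial free resolution `A^g → A → N → 0`. -/
theorem exists_ext_two_presentation (ε : A →ₗ[A] N) (hε : Function.Surjective ε)
    (d : (Fin g → A) →ₗ[A] A) (hd : LinearMap.range d = LinearMap.ker ε) :
    ∃ δ : (LinearMap.ker d →ₗ[A] A) →+ Ext (ModuleCat.of A N) (ModuleCat.of A A) 2,
      Function.Surjective δ ∧
      (∀ φ, δ φ = 0 ↔ ∃ ψ : (Fin g → A) →ₗ[A] A, φ = ψ ∘ₗ (LinearMap.ker d).subtype) ∧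
      ∀ φ a, δ (LinearMap.toSpanSingleton A A a ∘ₗ φ) = extRightAction (δ φ) a := by
  let d' : (Fin g → A) →ₗ[A] LinearMap.ker ε := d.codRestrict _ fun v => hd ▸ ⟨v, rfl⟩
  have hker : LinearMap.ker d' = LinearMap.ker d := LinearMap.ker_codRestrict _ _ _
  have hd' : Function.Surjective d' := by
    rintro ⟨a, ha⟩
    obtain ⟨v, rfl⟩ : a ∈ LinearMap.range d := hd ▸ ha
    exact ⟨v, rfl⟩
  rw [← hker]
  have hS₁ := kernelComplex_shortExact ε hε
  have hS₂ := kernelComplex_shortExact d' hd'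
  have p₁ : Projective (kernelComplex ε).X₂ :=
    (IsProjective.iff_projective A).1 inferInstance
  have p₂ : Projective (kernelComplex d').X₂ :=
    (IsProjective.iff_projective (Fin g → A)).1 inferInstance
  let Y := ModuleCat.of A A
  let mk : (LinearMap.ker d' →ₗ[A] A) → Ext (kernelComplex d').X₁ Y 0 :=
    fun φ => Ext.mk₀ (ModuleCat.ofHom φ)
  let c₁ : Ext (kernelComplex ε).X₁ Y 1 → Ext (kernelComplex ε).X₃ Y 2 :=
    fun ξ => hS₁.extClass.comp ξ rfl
  let c₂ : Ext (kernelComplex d').X₁ Y 0 → Ext (kernelComplex d').X₃ Y 1 :=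
    fun ξ => hS₂.extClass.comp ξ rfl
  -- The outer connecting map is injective because $\mathrm{Ext}^1(A,-)=0$; hence only the inner one
  -- contributes to the kernel of $\delta$.
  have c₁inj : ∀ ξ, c₁ ξ = 0 → ξ = 0 := fun ξ hξ => by
    obtain ⟨x₂, rfl⟩ := Ext.contravariant_sequence_exact₁ hS₁ _ ξ rfl hξ
    rw [x₂.eq_zero_of_hasProjectiveDimensionLT 1 le_rfl, Ext.comp_zero]
  refine ⟨⟨⟨fun φ => c₁ (c₂ (mk φ)), ?_⟩, ?_⟩, ?_, ?_, ?_⟩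
  · change hS₁.extClass.comp (hS₂.extClass.comp (Ext.mk₀ 0) _) _ = 0
    rw [Ext.mk₀_zero, Ext.comp_zero, Ext.comp_zero]
  · intro φ ψ
    change hS₁.extClass.comp (hS₂.extClass.comp
      (Ext.mk₀ (ModuleCat.ofHom φ + ModuleCat.ofHom ψ)) (add_zero 1)) (one_add_one_eq_two) = _
    rw [Ext.mk₀_add, Ext.comp_add, Ext.comp_add]
  · intro ξ
    obtain ⟨η, rfl⟩ := Ext.contravariant_sequence_exact₃ hS₁ _ ξ
      (Ext.eq_zero_of_hasProjectiveDimensionLT _ 1 one_le_two) (n₀ := 1) rfl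
    obtain ⟨ζ, rfl⟩ := Ext.contravariant_sequence_exact₃ hS₂ _ η
      (Ext.eq_zero_of_hasProjectiveDimensionLT _ 1 le_rfl) (n₀ := 0) rfl
    obtain ⟨φ, rfl⟩ := (Ext.mk₀_bijective _ _).2 ζ
    exact ⟨φ.hom, rfl⟩
  · intro φ
    change c₁ (c₂ (mk φ)) = 0 ↔ _
    constructor
    · intro h
      obtain ⟨x₂, hx₂⟩ := Ext.contravariant_sequence_exact₁ hS₂ _ (mk φ) rfl (c₁inj _ h)
      obtain ⟨ψ, rfl⟩ := (Ext.mk₀_bijective _ _).2 x₂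
      rw [Ext.mk₀_comp_mk₀] at hx₂
      exact ⟨ψ.hom, (congrArg ModuleCat.Hom.hom ((Ext.mk₀_bijective _ _).1 hx₂)).symm⟩
    · rintro ⟨ψ, rfl⟩
      have h0 : c₂ (mk (ψ ∘ₗ (LinearMap.ker d').subtype)) = 0 := by
        change hS₂.extClass.comp (Ext.mk₀ ((kernelComplex d').f ≫ ModuleCat.ofHom ψ)) _ = 0
        rw [← Ext.mk₀_comp_mk₀]
        exact hS₂.extClass_comp_assoc _
      rw [h0]
      exact Ext.comp_zero _ _ _ _ _
  -- The connecting maps compose on one side and the action of $A$ on the other, so associativity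
  -- suffices.
  · intro φ a
    change hS₁.extClass.comp (hS₂.extClass.comp
      (Ext.mk₀ (ModuleCat.ofHom φ ≫ rightMul a)) (add_zero 1)) one_add_one_eq_two =
      (hS₁.extClass.comp (hS₂.extClass.comp
      (Ext.mk₀ (ModuleCat.ofHom φ)) (add_zero 1)) one_add_one_eq_two).comp
        (Ext.mk₀ (rightMul a)) _
    rw [← Ext.mk₀_comp_mk₀, Ext.comp_assoc_of_third_deg_zero, Ext.comp_assoc_of_third_deg_zero]

end Homological

/-! ### Homogeneous components and the augmentation ideal. -/

section Graded

variable {K : Type u} [Field K] {A : Type u} [Ring A] [Algebra K A]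

/-- Used to see that the augmentation ideal is the left ideal generated by the $x_i$. -/
theorem exists_eq_algebraMap_add_sum_mul {g : ℕ} {x : Fin g → A}
    (hx : Algebra.adjoin K (Set.range x) = ⊤) (a : A) :
    ∃ (c : K) (v : Fin g → A), a = algebraMap K A c + ∑ i, v i * x i := by
  have ha : a ∈ Algebra.adjoin K (Set.range x) := hx ▸ Algebra.mem_top
  induction ha using Algebra.adjoin_induction with
  | mem y hy =>
    obtain ⟨i, rfl⟩ := hy
    exact ⟨0, Pi.single i 1, by simp [Pi.single_apply]⟩
  | algebraMap r => exact ⟨r, 0, by simp⟩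
  | add a b _ _ iha ihb =>
    obtain ⟨c, v, rfl⟩ := iha
    obtain ⟨c', v', rfl⟩ := ihb
    exact ⟨c + c', v + v', by simp [add_mul, Finset.sum_add_distrib]; abel⟩
  | mul a b _ _ iha ihb =>
    obtain ⟨c, v, rfl⟩ := iha
    obtain ⟨c', v', rfl⟩ := ihb
    -- With $a=c+\sum v_ix_i$, expand $a\,(c'+\sum v'_ix_i)=cc'+\sum(c'v_i+a\,v'_i)x_i$.
    refine ⟨c * c', fun i => c' • v i + (algebraMap K A c + ∑ i, v i * x i) * v' i, ?_⟩
    simp only [add_mul, mul_add, Finset.sum_add_distrib, map_mul, mul_assoc, Finset.mul_sum,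
      ← Algebra.commutes c', Finset.sum_mul, ← Algebra.smul_def, smul_mul_assoc]
    abel

theorem exists_eq_algebraMap_add_mul_sum {g : ℕ} {x : Fin g → A}
    (hx : Algebra.adjoin K (Set.range x) = ⊤) (a : A) :
    ∃ (c : K) (v : Fin g → A), a = algebraMap K A c + ∑ i, x i * v i := by
  have ha : a ∈ Algebra.adjoin K (Set.range x) := hx ▸ Algebra.mem_top
  induction ha using Algebra.adjoin_induction with
  | mem y hy =>
    obtain ⟨i, rfl⟩ := hy
    exact ⟨0, Pi.single i 1, by simp [Pi.single_apply]⟩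
  | algebraMap r => exact ⟨r, 0, by simp⟩
  | add a b _ _ iha ihb =>
    obtain ⟨c, v, rfl⟩ := iha
    obtain ⟨c', v', rfl⟩ := ihb
    exact ⟨c + c', v + v', by simp [mul_add, Finset.sum_add_distrib]; abel⟩
  | mul a b _ _ iha ihb =>
    obtain ⟨c, v, rfl⟩ := iha
    obtain ⟨c', v', hb⟩ := ihb
    refine ⟨c * c', fun i => c • v' i + v i * b, ?_⟩
    have hcb : algebraMap K A c * b = algebraMap K A (c * c') + ∑ i, x i * (c • v' i) := by
      rw [hb, mul_add, map_mul, ← Algebra.smul_def c (∑ i, _), Finset.smul_sum]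
      simp only [mul_smul_comm]
    rw [add_mul, hcb, Finset.sum_mul]
    simp only [mul_add, Finset.sum_add_distrib, mul_assoc, add_assoc]

theorem adjoin_range_eq_top {𝒜 : ℕ → Submodule K A} {g : ℕ} {x : Fin g → A}
    (hx : Submodule.span K (Set.range x) = 𝒜 1) (hgen : Function.Surjective (tensorToAlg 𝒜)) :
    Algebra.adjoin K (Set.range x) = ⊤ := by
  rw [eq_top_iff]
  rintro a -
  obtain ⟨t, rfl⟩ := hgen a
  induction t using TensorAlgebra.induction with
  | algebraMap r => rw [AlgHom.commutes]; exact Subalgebra.algebraMap_mem _ _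
  | ι e =>
    have : tensorToAlg 𝒜 (TensorAlgebra.ι K e) = e := by simp [tensorToAlg]
    rw [this]
    exact Algebra.span_le_adjoin K _ (hx.symm.le e.2)
  | mul a b ha hb => rw [map_mul]; exact mul_mem ha hb
  | add a b ha hb => rw [map_add]; exact add_mem ha hb

variable (𝒜 : ℕ → Submodule K A) [GradedAlgebra 𝒜]

theorem proj_succ_mul {a x : A} (hx : x ∈ 𝒜 1) (n : ℕ) :
    GradedAlgebra.proj 𝒜 (n + 1) (a * x) = GradedAlgebra.proj 𝒜 n a * x :=
  DirectSum.coe_decompose_mul_add_of_right_mem 𝒜 hx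

theorem proj_zero_mul {a x : A} (hx : x ∈ 𝒜 1) : GradedAlgebra.proj 𝒜 0 (a * x) = 0 :=
  DirectSum.coe_decompose_mul_of_right_mem_of_not_le 𝒜 hx (by simp)

theorem proj_mul_succ {a x : A} (hx : x ∈ 𝒜 1) (n : ℕ) :
    GradedAlgebra.proj 𝒜 (n + 1) (x * a) = x * GradedAlgebra.proj 𝒜 n a := by
  rw [add_comm]; exact DirectSum.coe_decompose_mul_add_of_left_mem 𝒜 hx

theorem proj_mul_zero {a x : A} (hx : x ∈ 𝒜 1) : GradedAlgebra.proj 𝒜 0 (x * a) = 0 :=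
  DirectSum.coe_decompose_mul_of_left_mem_of_not_le 𝒜 hx (by simp)

theorem proj_mem (n : ℕ) (a : A) : GradedAlgebra.proj 𝒜 n a ∈ 𝒜 n := SetLike.coe_mem _

theorem proj_of_mem {n : ℕ} {a : A} (ha : a ∈ 𝒜 n) : GradedAlgebra.proj 𝒜 n a = a :=
  DirectSum.decompose_of_mem_same 𝒜 ha

theorem proj_of_mem_ne {m n : ℕ} {a : A} (ha : a ∈ 𝒜 m) (h : m ≠ n) :
    GradedAlgebra.proj 𝒜 n a = 0 :=
  DirectSum.decompose_of_mem_ne 𝒜 ha h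

theorem eq_zero_of_proj_eq_zero {a : A} (h : ∀ n, GradedAlgebra.proj 𝒜 n a = 0) : a = 0 := by
  apply (DirectSum.decompose 𝒜).injective
  ext n
  rw [DirectSum.decompose_zero]
  exact h n

theorem exists_eq_sum_proj (a : A) :
    ∃ N, ∀ n, N ≤ n → a = ∑ i ∈ Finset.range n, GradedAlgebra.proj 𝒜 i a := by
  classical
  refine ⟨((DirectSum.decompose 𝒜 a).support).sup id + 1, fun n hn => ?_⟩
  conv_lhs => rw [← DirectSum.sum_support_decompose 𝒜 a]
  refine Finset.sum_subset (fun i hi => ?_) fun i _ hi => ?_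
  · have := Finset.le_sup (f := id) hi
    simp only [id] at this
    exact Finset.mem_range.2 (by omega)
  · simpa using hi

theorem proj_algebraMap_of_ne_zero {n : ℕ} (hn : n ≠ 0) (c : K) :
    GradedAlgebra.proj 𝒜 n (algebraMap K A c) = 0 :=
  proj_of_mem_ne 𝒜 (SetLike.algebraMap_mem_graded 𝒜 c) hn.symm

variable {𝒜}

theorem exists_eq_sum_mul_of_mem_succ {g : ℕ} {x : Fin g → A} (hx1 : ∀ i, x i ∈ 𝒜 1)
    (hx : Algebra.adjoin K (Set.range x) = ⊤) {n : ℕ} {a : A} (ha : a ∈ 𝒜 (n + 1)) :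
    ∃ v : Fin g → A, (∀ i, v i ∈ 𝒜 n) ∧ a = ∑ i, v i * x i := by
  obtain ⟨c, v, h⟩ := exists_eq_algebraMap_add_sum_mul hx a
  refine ⟨fun i => GradedAlgebra.proj 𝒜 n (v i), fun i => proj_mem 𝒜 n _, ?_⟩
  have := congrArg (GradedAlgebra.proj 𝒜 (n + 1)) h
  rw [proj_of_mem 𝒜 ha, map_add, proj_algebraMap_of_ne_zero 𝒜 (Nat.succ_ne_zero n), zero_add,
    map_sum] at this
  simpa only [proj_succ_mul 𝒜 (hx1 _)] using this

section Augmentation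

variable [IsConnectedGraded 𝒜]

theorem algebraMap_augmentation (a : A) :
    algebraMap K A (augmentation 𝒜 a) = GradedAlgebra.proj 𝒜 0 a := by
  have h := (RingEquiv.ofBijective (algebraMap K (𝒜 0))
    IsConnectedGraded.bijective_algebraMap).apply_symm_apply (GradedRing.projZeroRingHom' 𝒜 a)
  exact congrArg Subtype.val h

theorem algebraMap_injective (𝒜 : ℕ → Submodule K A) [GradedAlgebra 𝒜] [IsConnectedGraded 𝒜] :
    Function.Injective (algebraMap K A) := fun _ _ h =>
  (IsConnectedGraded.bijective_algebraMap (𝒜 := 𝒜)).1 (Subtype.ext h)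

theorem augmentation_algebraMap (c : K) : augmentation 𝒜 (algebraMap K A c) = c := by
  apply algebraMap_injective 𝒜
  rw [algebraMap_augmentation, proj_of_mem 𝒜 (SetLike.algebraMap_mem_graded 𝒜 c)]

theorem augmentation_eq_zero_iff {a : A} :
    augmentation 𝒜 a = 0 ↔ GradedAlgebra.proj 𝒜 0 a = 0 := by
  rw [← algebraMap_augmentation, map_eq_zero_iff _ (algebraMap_injective 𝒜)]

theorem augmentation_of_mem_one {a : A} (ha : a ∈ 𝒜 1) : augmentation 𝒜 a = 0 :=
  augmentation_eq_zero_iff.2 (proj_of_mem_ne 𝒜 ha one_ne_zero)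

variable (𝒜) in
/-- The linear map `ε : A → N` identifies `N` with the trivial module. -/
structure IsAugmentation {N : Type*} [AddCommGroup N] [Module A N] (ε : A →ₗ[A] N) : Prop where
  surjective : Function.Surjective ε
  eq_zero_iff : ∀ a, ε a = 0 ↔ augmentation 𝒜 a = 0

variable (𝒜) in
/-- The augmentation as a morphism onto the trivial module. -/
def augmentationHom : ModuleCat.of A A ⟶ trivialModule 𝒜 :=
  letI : Module A K := Module.compHom K (augmentation 𝒜)
  show ModuleCat.of A A ⟶ ModuleCat.of A K from ModuleCat.ofHom
    { toFun := fun a => augmentation 𝒜 a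
      map_add' := fun a b => map_add _ a b
      map_smul' := fun a b => map_mul (augmentation 𝒜) a b }

variable (𝒜) in
theorem isAugmentation_augmentationHom : IsAugmentation 𝒜 (augmentationHom 𝒜).hom where
  surjective c := ⟨algebraMap K A c, augmentation_algebraMap (𝒜 := 𝒜) c⟩
  eq_zero_iff _ := Iff.rfl

theorem IsAugmentation.range_linearCombination_eq_ker {N : Type*} [AddCommGroup N] [Module A N]
    {ε : A →ₗ[A] N} (hε : IsAugmentation 𝒜 ε) {g : ℕ} {x : Fin g → A} (hx1 : ∀ i, x i ∈ 𝒜 1)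
    (hx : Algebra.adjoin K (Set.range x) = ⊤) :
    LinearMap.range (Fintype.linearCombination A x) = LinearMap.ker ε := by
  ext a
  rw [LinearMap.mem_ker, hε.eq_zero_iff]
  constructor
  · rintro ⟨v, rfl⟩
    simp [Fintype.linearCombination_apply, augmentation_of_mem_one (hx1 _)]
  · intro ha
    obtain ⟨c, v, rfl⟩ := exists_eq_algebraMap_add_sum_mul hx a
    have : c = 0 := by
      simpa [augmentation_of_mem_one (hx1 _), augmentation_algebraMap] using ha
    exact ⟨v, by simp [this, Fintype.linearCombination_apply]⟩

end Augmentation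

end Graded

/-! ### The quadratic algebra: recursion along generators and syzygies. -/

namespace QuadAlg

variable {K : Type u} [Field K] {g : ℕ} (b : LinearMap.BilinForm K (Fin g → K))

/-- The universal property of the quadratic algebra. -/
def liftHom {B : Type*} [Semiring B] [Algebra K B] (f : Fin g → B)
    (hf : ∑ μ, ∑ ν, comp b μ ν • (f μ * f ν) = 0) : QuadAlg b →ₐ[K] B :=
  RingQuot.liftAlgHom K ⟨FreeAlgebra.lift K f, by
    rintro _ _ ⟨⟩
    simpa [relator] using hf⟩

@[simp]
theorem liftHom_gen {B : Type*} [Semiring B] [Algebra K B] (f : Fin g → B)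
    (hf : ∑ μ, ∑ ν, comp b μ ν • (f μ * f ν) = 0) (μ : Fin g) :
    liftHom b f hf (gen b μ) = f μ := by
  simp [liftHom, gen]

variable {b} in
theorem hom_ext {B : Type*} [Semiring B] [Algebra K B] {f f' : QuadAlg b →ₐ[K] B}
    (h : ∀ μ, f (gen b μ) = f' (gen b μ)) : f = f' := by
  apply RingQuot.ringQuot_ext'
  apply FreeAlgebra.hom_ext
  funext μ
  exact h μ

theorem adjoin_gen : Algebra.adjoin K (Set.range (gen b)) = ⊤ := by
  have h : (RingQuot.mkAlgHom K (Rel b)).range = ⊤ :=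
    (AlgHom.range_eq_top _).2 (RingQuot.mkAlgHom_surjective K _)
  rw [← h, ← Algebra.map_top, ← FreeAlgebra.adjoin_range_ι, AlgHom.map_adjoin, ← Set.range_comp]
  rfl

/-- The element `∑ b(e_μ, e_ν) x^μ`, so that the relation reads `∑ leftPart ν * x^ν = 0`. -/
def leftPart (ν : Fin g) : QuadAlg b := ∑ μ, comp b μ ν • gen b μ

/-- The element `∑ b(e_μ, e_ν) x^ν`, so that the relation reads `∑ x^μ * rightPart μ = 0`. -/
def rightPart (μ : Fin g) : QuadAlg b := ∑ ν, comp b μ ν • gen b ν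

theorem sum_leftPart_mul : ∑ ν, leftPart b ν * gen b ν = 0 := by
  rw [← relation b, Finset.sum_comm]
  simp [leftPart, Finset.sum_mul]

section Derivation

variable {P : Type*} [AddCommGroup P] [Module K P]

/-- A map on `A` may be prescribed recursively along right multiplication by the generators if
the recursion is compatible with the relation. -/
theorem exists_linearMap_mul_gen (r : Fin g → QuadAlg b × P →ₗ[K] P)
    (hr : ∀ a p, ∑ μ, ∑ ν, comp b μ ν • r ν (a * gen b μ, r μ (a, p)) = 0) :
    ∃ D : QuadAlg b →ₗ[K] P, ∀ a μ, D (a * gen b μ) = r μ (a, D a) := by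
  -- One step of the recursion acts on pairs (element, value). The hypothesis `hr` says that these
  -- operators satisfy the defining relation, so they extend to an action of the whole algebra.
  let R : Fin g → Module.End K (QuadAlg b × P) := fun μ =>
    (LinearMap.mulRight K (gen b μ) ∘ₗ LinearMap.fst K _ _).prod (r μ)
  have hR' : ∑ μ, ∑ ν, comp b μ ν • (R ν * R μ) = 0 := by
    refine LinearMap.ext fun ⟨a, p⟩ => Prod.ext ?_ ?_
    · simp only [LinearMap.sum_apply, Prod.fst_sum, LinearMap.smul_apply, Prod.smul_fst,
        Module.End.mul_apply, LinearMap.zero_apply, Prod.fst_zero]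
      change ∑ μ, ∑ ν, comp b μ ν • (a * gen b μ * gen b ν) = 0
      rw [← mul_zero a, ← relation b]
      simp only [Finset.mul_sum, mul_smul_comm, mul_assoc]
    · simp only [LinearMap.sum_apply, Prod.snd_sum, LinearMap.smul_apply, Prod.smul_snd,
        Module.End.mul_apply, LinearMap.zero_apply, Prod.snd_zero]
      exact hr a p
  -- Right multiplications compose in the reverse order, hence the opposite algebra.
  have hR : ∑ μ, ∑ ν, comp b μ ν • (MulOpposite.op (R μ) * MulOpposite.op (R ν)) = 0 := by
    have := congrArg (MulOpposite.opLinearEquiv K) hR'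
    simp only [map_sum, map_smul, map_zero] at this
    exact this
  let Φ := liftHom b (fun μ => MulOpposite.op (R μ)) hR
  have hmul : ∀ a c p, (Φ (a * c)).unop p = (Φ c).unop ((Φ a).unop p) := fun a c p => by
    rw [map_mul]; rfl
  have hgen : ∀ μ, (Φ (gen b μ)).unop = R μ := fun μ => by
    simp [Φ]
  have hfst : ∀ a p, ((Φ a).unop p).1 = p.1 * a := fun a => by
    have ha : a ∈ Algebra.adjoin K (Set.range (gen b)) := adjoin_gen b ▸ Algebra.mem_top
    induction ha using Algebra.adjoin_induction with
    | mem y hy =>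
      obtain ⟨μ, rfl⟩ := hy
      intro p; rw [hgen]; rfl
    | algebraMap c =>
      intro p
      rw [AlgHom.commutes, ← Algebra.commutes, ← Algebra.smul_def]; rfl
    | add a c _ _ iha ihc => intro p; rw [map_add, mul_add, ← iha, ← ihc]; rfl
    | mul a c _ _ iha ihc => intro p; rw [hmul, ihc, iha, mul_assoc]
  -- Starting from $(1,0)$, the element $a$ leads to the pair $(a,D(a))$, by `hfst`; this defines
  -- $D$.
  refine ⟨LinearMap.snd K _ _ ∘ₗ LinearMap.applyₗ (1, 0) ∘ₗ
    (MulOpposite.opLinearEquiv K).symm.toLinearMap ∘ₗ Φ.toLinearMap, fun a μ => ?_⟩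
  change ((Φ (a * gen b μ)).unop (1, 0)).2 = r μ (a, ((Φ a).unop (1, 0)).2)
  rw [hmul, hgen]
  change r μ ((Φ a).unop (1, 0)) = _
  congr 1
  exact Prod.ext (by rw [hfst, one_mul]) rfl

/-- The mirror image of `exists_linearMap_mul_gen`; left multiplications compose in the order of the
product, so no opposite algebra is needed. -/
theorem exists_linearMap_gen_mul (r : Fin g → QuadAlg b × P →ₗ[K] P)
    (hr : ∀ a p, ∑ μ, ∑ ν, comp b μ ν • r μ (gen b ν * a, r ν (a, p)) = 0) :
    ∃ D : QuadAlg b →ₗ[K] P, ∀ a μ, D (gen b μ * a) = r μ (a, D a) := by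
  let R : Fin g → Module.End K (QuadAlg b × P) := fun μ =>
    (LinearMap.mulLeft K (gen b μ) ∘ₗ LinearMap.fst K _ _).prod (r μ)
  have hR : ∑ μ, ∑ ν, comp b μ ν • (R μ * R ν) = 0 := by
    refine LinearMap.ext fun ⟨a, p⟩ => Prod.ext ?_ ?_
    · simp only [LinearMap.sum_apply, Prod.fst_sum, LinearMap.smul_apply, Prod.smul_fst,
        Module.End.mul_apply, LinearMap.zero_apply, Prod.fst_zero]
      change ∑ μ, ∑ ν, comp b μ ν • (gen b μ * (gen b ν * a)) = 0
      rw [← zero_mul a, ← relation b]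
      simp only [Finset.sum_mul, smul_mul_assoc, mul_assoc]
    · simp only [LinearMap.sum_apply, Prod.snd_sum, LinearMap.smul_apply, Prod.smul_snd,
        Module.End.mul_apply, LinearMap.zero_apply, Prod.snd_zero]
      exact hr a p
  let Φ := liftHom b R hR
  have hgen : ∀ μ, Φ (gen b μ) = R μ := fun μ => by simp [Φ]
  have hfst : ∀ a p, (Φ a p).1 = a * p.1 := fun a => by
    have ha : a ∈ Algebra.adjoin K (Set.range (gen b)) := adjoin_gen b ▸ Algebra.mem_top
    induction ha using Algebra.adjoin_induction with
    | mem y hy =>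
      obtain ⟨μ, rfl⟩ := hy
      intro p; rw [hgen]; rfl
    | algebraMap c =>
      intro p
      rw [AlgHom.commutes, ← Algebra.smul_def]; rfl
    | add a c _ _ iha ihc => intro p; rw [map_add, add_mul, ← iha, ← ihc]; rfl
    | mul a c _ _ iha ihc => intro p; rw [map_mul, Module.End.mul_apply, iha, ihc, mul_assoc]
  refine ⟨LinearMap.snd K _ _ ∘ₗ LinearMap.applyₗ (1, 0) ∘ₗ Φ.toLinearMap, fun a μ => ?_⟩
  change (Φ (gen b μ * a) (1, 0)).2 = r μ (a, (Φ a (1, 0)).2)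
  rw [map_mul, hgen]
  change r μ (Φ a (1, 0)) = _
  congr 1
  exact Prod.ext (by rw [hfst, mul_one]) rfl

end Derivation

/-- Exactness at $A^g$. The recursion $D(a x^\mu)=[a e_\mu]$, with values in $A^g$ modulo multiples
of `leftPart`, is consistent because the relator goes to $[a\cdot\mathrm{leftPart}]=0$. Then $D(\sum
v_\nu x^\nu)=[v]$, so a syzygy has zero class. -/
theorem exists_eq_mul_leftPart {v : Fin g → QuadAlg b} (hv : ∑ ν, v ν * gen b ν = 0) :
    ∃ t, ∀ ν, v ν = t * leftPart b ν := by
  let S : Submodule K (Fin g → QuadAlg b) :=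
    LinearMap.range (LinearMap.pi fun ν => LinearMap.mulRight K (leftPart b ν))
  obtain ⟨D, hD⟩ := exists_linearMap_mul_gen b
    (fun μ => S.mkQ ∘ₗ LinearMap.single K _ μ ∘ₗ LinearMap.fst K _ ((Fin g → QuadAlg b) ⧸ S)) (by
      intro a p
      change ∑ μ, ∑ ν, comp b μ ν • S.mkQ (Pi.single ν (a * gen b μ)) = 0
      simp only [← map_smul, ← map_sum]
      rw [Submodule.mkQ_apply, Submodule.Quotient.mk_eq_zero]
      refine ⟨a, ?_⟩
      funext ν
      simp [leftPart, Finset.mul_sum, Finset.sum_apply, Pi.single_apply])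
  have h : S.mkQ v = 0 := by
    rw [← map_zero D, ← hv, map_sum]
    simp only [hD]
    change _ = ∑ μ, S.mkQ (Pi.single μ (v μ))
    rw [← map_sum, Finset.univ_sum_single]
  obtain ⟨t, rfl⟩ := (Submodule.Quotient.mk_eq_zero S).1 h
  exact ⟨t, fun _ => rfl⟩

theorem exists_eq_rightPart_mul {v : Fin g → QuadAlg b} (hv : ∑ μ, gen b μ * v μ = 0) :
    ∃ u, ∀ μ, v μ = rightPart b μ * u := by
  let S : Submodule K (Fin g → QuadAlg b) :=
    LinearMap.range (LinearMap.pi fun ν => LinearMap.mulLeft K (rightPart b ν))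
  obtain ⟨D, hD⟩ := exists_linearMap_gen_mul b
    (fun μ => S.mkQ ∘ₗ LinearMap.single K _ μ ∘ₗ LinearMap.fst K _ ((Fin g → QuadAlg b) ⧸ S)) (by
      intro a p
      change ∑ μ, ∑ ν, comp b μ ν • S.mkQ (Pi.single μ (gen b ν * a)) = 0
      simp only [← map_smul, ← map_sum]
      rw [Submodule.mkQ_apply, Submodule.Quotient.mk_eq_zero]
      refine ⟨a, ?_⟩
      funext ν
      simp [rightPart, Finset.sum_mul, Finset.sum_apply, Pi.single_apply])
  have h : S.mkQ v = 0 := by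
    rw [← map_zero D, ← hv, map_sum]
    simp only [hD]
    change _ = ∑ μ, S.mkQ (Pi.single μ (v μ))
    rw [← map_sum, Finset.univ_sum_single]
  obtain ⟨t, rfl⟩ := (Submodule.Quotient.mk_eq_zero S).1 h
  exact ⟨t, fun _ => rfl⟩

/-- The quotient of the algebra by the elements of degree at least two. -/
def toTrivSqZero : QuadAlg b →ₐ[K] TrivSqZeroExt K (Fin g → K) :=
  liftHom b (fun μ => TrivSqZeroExt.inr (Pi.single μ 1)) (by simp)

theorem algebraMap_injective : Function.Injective (algebraMap K (QuadAlg b)) := by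
  intro c c' h
  have := congrArg (fun a => (toTrivSqZero b a).fst) h
  simpa [TrivSqZeroExt.algebraMap_eq_inl] using this

theorem linearIndependent_gen : LinearIndependent K (gen b) := by
  rw [Fintype.linearIndependent_iff]
  intro c hc μ
  have := congrArg (fun a => (toTrivSqZero b a).snd μ) hc
  simpa [toTrivSqZero, TrivSqZeroExt.snd_sum, Pi.single_apply] using this

theorem grading_one : grading b 1 = Submodule.span K (Set.range (gen b)) := pow_one _

instance : IsConnectedGraded (grading b) where
  bijective_algebraMap := by
    refine ⟨fun c c' h => algebraMap_injective b (congrArg Subtype.val h), fun ⟨a, ha⟩ => ?_⟩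
    change a ∈ Submodule.span K (Set.range (gen b)) ^ 0 at ha
    rw [pow_zero, Submodule.mem_one] at ha
    obtain ⟨c, rfl⟩ := ha
    exact ⟨c, rfl⟩

end QuadAlg

/-! ### Linear forms are not zero divisors. -/

theorem exists_ne_zero_sum_mul_eq_zero {K : Type*} [Field K] {g : ℕ} (hg : 2 ≤ g)
    (c : Fin g → K) : ∃ c' : Fin g → K, c' ≠ 0 ∧ ∑ ν, c' ν * c ν = 0 := by
  let i : Fin g := ⟨0, by omega⟩
  let j : Fin g := ⟨1, by omega⟩
  have hij : i ≠ j := by simp [i, j]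
  by_cases h : c i = 0
  · exact ⟨Pi.single i 1, by simp, by simp [Pi.single_apply, h]⟩
  · refine ⟨Pi.single i (c j) - Pi.single j (c i), fun h0 => h ?_, ?_⟩
    · have := congrFun h0 j
      simpa [hij.symm] using this
    · simp [sub_mul, Finset.sum_sub_distrib, Pi.single_apply, mul_comm (c j)]

namespace QuadAlg

variable {K : Type u} [Field K] {g : ℕ} (b : LinearMap.BilinForm K (Fin g → K))

theorem sum_comp_mul (μ : Fin g) (c : Fin g → K) :
    ∑ ν, comp b μ ν * c ν = b (Pi.single μ 1) c := by
  conv_rhs => rw [pi_eq_sum_univ' c, map_sum]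
  simp [comp, mul_comm]

theorem sum_mul_comp (ν : Fin g) (c : Fin g → K) :
    ∑ μ, c μ * comp b μ ν = b c (Pi.single ν 1) := by
  conv_rhs => rw [pi_eq_sum_univ' c, map_sum]
  simp [comp]

theorem apply_eq_sum (v w : Fin g → K) : b v w = ∑ μ, ∑ ν, comp b μ ν * (v μ * w ν) := by
  conv_lhs => rw [pi_eq_sum_univ' v, map_sum]
  simp only [LinearMap.sum_apply, map_smul, LinearMap.smul_apply, ← sum_comp_mul, smul_eq_mul,
    Finset.mul_sum]
  exact Finset.sum_congr rfl fun _ _ => Finset.sum_congr rfl fun _ _ => by ring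

variable {b}

theorem apply_single_left_ne_zero (hb : b.Nondegenerate) {c : Fin g → K} (hc : c ≠ 0) :
    (fun μ => b (Pi.single μ 1) c) ≠ 0 := fun h => hc <| hb.2 c fun v => by
  rw [pi_eq_sum_univ' v, map_sum]
  simp [fun μ => congrFun h μ]

theorem apply_single_right_ne_zero (hb : b.Nondegenerate) {c : Fin g → K} (hc : c ≠ 0) :
    (fun μ => b c (Pi.single μ 1)) ≠ 0 := fun h => hc <| hb.1 c fun v => by
  rw [pi_eq_sum_univ' v, map_sum]
  simp [fun μ => congrFun h μ]

theorem sum_smul_leftPart (c : Fin g → K) :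
    ∑ ν, c ν • leftPart b ν = ∑ μ, b (Pi.single μ 1) c • gen b μ := by
  simp only [leftPart, Finset.smul_sum, smul_smul, ← sum_comp_mul, Finset.sum_smul]
  rw [Finset.sum_comm]
  simp only [mul_comm]

theorem sum_smul_rightPart (c : Fin g → K) :
    ∑ μ, c μ • rightPart b μ = ∑ ν, b c (Pi.single ν 1) • gen b ν := by
  simp only [rightPart, Finset.smul_sum, smul_smul, ← sum_mul_comp, Finset.sum_smul]
  rw [Finset.sum_comm]

theorem sum_smul_gen_mem (c : Fin g → K) : ∑ μ, c μ • gen b μ ∈ grading b 1 :=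
  sum_mem fun μ _ => Submodule.smul_mem _ _ (gen_mem b μ)

theorem leftPart_mem (ν : Fin g) : leftPart b ν ∈ grading b 1 := sum_smul_gen_mem _

theorem rightPart_mem (μ : Fin g) : rightPart b μ ∈ grading b 1 := sum_smul_gen_mem _

/-- Induction on the degree of $a$. The syzygy $(c_\nu a)_\nu$ equals $t\cdot\mathrm{leftPart}$ with
$t$ one degree lower. Pairing with some $c'\ne 0$ orthogonal to $c$, which exists because $g\ge 2$,
shows that $t$ kills the form $\sum c'_\nu\,\mathrm{leftPart}_\nu$; this form is nonzero by
nondegeneracy, so $t=0$. -/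
theorem eq_zero_of_mem_of_mul_linear (hg : 2 ≤ g) (hb : b.Nondegenerate) {n : ℕ} {a : QuadAlg b}
    (ha : a ∈ grading b n) {c : Fin g → K} (hc : c ≠ 0) (h : a * ∑ ν, c ν • gen b ν = 0) :
    a = 0 := by
  obtain ⟨i, hi⟩ := Function.ne_iff.1 hc
  have h' : ∑ ν, (c ν • a) * gen b ν = 0 := by
    rw [← h, Finset.mul_sum]; simp
  obtain ⟨t, ht⟩ := exists_eq_mul_leftPart b h'
  suffices c i • a = 0 from (smul_eq_zero.1 this).resolve_left hi
  induction n generalizing a c i t with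
  | zero =>
    -- In degree 0 there is nothing below: a multiple of a linear form has no component of degree 0.
    have := proj_zero_mul (grading b) (a := t) (leftPart_mem i)
    rwa [← ht, map_smul, proj_of_mem _ ha] at this
  | succ n ih =>
    obtain ⟨c', hc', hcc⟩ := exists_ne_zero_sum_mul_eq_zero hg c
    have ht' : ∀ ν, c ν • a = GradedAlgebra.proj (grading b) n t * leftPart b ν := fun ν => by
      rw [← proj_succ_mul _ (leftPart_mem ν), ← ht, map_smul, proj_of_mem _ ha]
    have h0 : GradedAlgebra.proj (grading b) n t *
        ∑ μ, b (Pi.single μ 1) c' • gen b μ = 0 := by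
      rw [← sum_smul_leftPart, Finset.mul_sum]
      simp only [mul_smul_comm, ← ht', smul_smul, ← Finset.sum_smul, hcc, zero_smul]
    have hc'' := apply_single_left_ne_zero hb hc'
    obtain ⟨j, hj⟩ := Function.ne_iff.1 hc''
    have h0' : ∑ ν, (b (Pi.single ν 1) c' • GradedAlgebra.proj (grading b) n t) * gen b ν = 0 := by
      rw [← h0, Finset.mul_sum]; simp
    obtain ⟨s, hs⟩ := exists_eq_mul_leftPart b h0'
    have := ih (proj_mem _ n t) hc'' h0 j hj h0' s hs
    rw [ht', (smul_eq_zero.1 this).resolve_left hj, zero_mul]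

theorem eq_zero_of_mem_of_linear_mul (hg : 2 ≤ g) (hb : b.Nondegenerate) {n : ℕ} {a : QuadAlg b}
    (ha : a ∈ grading b n) {c : Fin g → K} (hc : c ≠ 0) (h : (∑ ν, c ν • gen b ν) * a = 0) :
    a = 0 := by
  obtain ⟨i, hi⟩ := Function.ne_iff.1 hc
  have h' : ∑ ν, gen b ν * (c ν • a) = 0 := by
    rw [← h, Finset.sum_mul]; simp
  obtain ⟨t, ht⟩ := exists_eq_rightPart_mul b h'
  suffices c i • a = 0 from (smul_eq_zero.1 this).resolve_left hi
  induction n generalizing a c i t with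
  | zero =>
    have := proj_mul_zero (grading b) (a := t) (rightPart_mem i)
    rwa [← ht, map_smul, proj_of_mem _ ha] at this
  | succ n ih =>
    obtain ⟨c', hc', hcc⟩ := exists_ne_zero_sum_mul_eq_zero hg c
    have ht' : ∀ ν, c ν • a = rightPart b ν * GradedAlgebra.proj (grading b) n t := fun ν => by
      rw [← proj_mul_succ _ (rightPart_mem ν), ← ht, map_smul, proj_of_mem _ ha]
    have h0 : (∑ μ, b c' (Pi.single μ 1) • gen b μ) *
        GradedAlgebra.proj (grading b) n t = 0 := by
      rw [← sum_smul_rightPart, Finset.sum_mul]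
      simp only [smul_mul_assoc, ← ht', smul_smul, ← Finset.sum_smul, hcc, zero_smul]
    have hc'' := apply_single_right_ne_zero hb hc'
    obtain ⟨j, hj⟩ := Function.ne_iff.1 hc''
    have h0' : ∑ ν, gen b ν * (b c' (Pi.single ν 1) • GradedAlgebra.proj (grading b) n t) = 0 := by
      rw [← h0, Finset.sum_mul]; simp
    obtain ⟨s, hs⟩ := exists_eq_rightPart_mul b h0'
    have := ih (proj_mem _ n t) hc'' h0 j hj h0' s hs
    rw [ht', (smul_eq_zero.1 this).resolve_left hj, mul_zero]

/-- Right multiplication by a nonzero element of degree one is injective. -/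
theorem eq_zero_of_mul_linear (hg : 2 ≤ g) (hb : b.Nondegenerate) {a : QuadAlg b}
    {c : Fin g → K} (hc : c ≠ 0) (h : a * ∑ ν, c ν • gen b ν = 0) : a = 0 :=
  eq_zero_of_proj_eq_zero (grading b) fun n =>
    eq_zero_of_mem_of_mul_linear hg hb (proj_mem _ n a) hc <| by
      rw [← proj_succ_mul _ (sum_smul_gen_mem c), h, map_zero]

/-- Left multiplication by a nonzero element of degree one is injective. -/
theorem eq_zero_of_linear_mul (hg : 2 ≤ g) (hb : b.Nondegenerate) {a : QuadAlg b}
    {c : Fin g → K} (hc : c ≠ 0) (h : (∑ ν, c ν • gen b ν) * a = 0) : a = 0 :=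
  eq_zero_of_proj_eq_zero (grading b) fun n =>
    eq_zero_of_mem_of_linear_mul hg hb (proj_mem _ n a) hc <| by
      rw [← proj_mul_succ _ (sum_smul_gen_mem c), h, map_zero]

theorem exists_smul_leftPart (ν : Fin g) (hb : b.Nondegenerate) :
    ∃ c : Fin g → K, c ≠ 0 ∧ leftPart b ν = ∑ μ, c μ • gen b μ := by
  refine ⟨_, apply_single_left_ne_zero hb (c := Pi.single ν 1) (by simp), ?_⟩
  rw [← sum_smul_leftPart]
  simp [Pi.single_apply]

theorem eq_zero_of_mul_leftPart (hg : 2 ≤ g) (hb : b.Nondegenerate) {a : QuadAlg b} (ν : Fin g)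
    (h : a * leftPart b ν = 0) : a = 0 := by
  obtain ⟨c, hc, hν⟩ := exists_smul_leftPart ν hb
  exact eq_zero_of_mul_linear hg hb hc (hν ▸ h)

end QuadAlg

/-! ### The Koszul resolution of an arbitrary module. -/

section Homological

variable {A : Type u} [Ring A]

theorem hasProjectiveDimensionLT_three_of_resolution {P₀ P₁ P₂ M : Type u}
    [AddCommGroup P₀] [Module A P₀] [AddCommGroup P₁] [Module A P₁]
    [AddCommGroup P₂] [Module A P₂] [AddCommGroup M] [Module A M]
    [Module.Projective A P₀] [Module.Projective A P₁] [Module.Projective A P₂]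
    (d₀ : P₀ →ₗ[A] M) (d₁ : P₁ →ₗ[A] P₀) (d₂ : P₂ →ₗ[A] P₁) (h₀ : Function.Surjective d₀)
    (h₁ : LinearMap.range d₁ = LinearMap.ker d₀) (h₂ : LinearMap.range d₂ = LinearMap.ker d₁)
    (h₃ : Function.Injective d₂) : HasProjectiveDimensionLT (ModuleCat.of A M) 3 := by
  let d' : P₁ →ₗ[A] LinearMap.ker d₀ := d₁.codRestrict _ fun v => h₁ ▸ ⟨v, rfl⟩
  have hker : LinearMap.ker d' = LinearMap.ker d₁ := LinearMap.ker_codRestrict _ _ _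
  have hd' : Function.Surjective d' := by
    rintro ⟨a, ha⟩
    obtain ⟨v, rfl⟩ : a ∈ LinearMap.range d₁ := h₁ ▸ ha
    exact ⟨v, rfl⟩
  have : Module.Projective A (LinearMap.ker d') :=
    Module.Projective.of_equiv ((LinearEquiv.ofInjective d₂ h₃).trans
      (LinearEquiv.ofEq _ _ (h₂.trans hker.symm)))
  have p₀ : Projective (ModuleCat.of A P₀) := (IsProjective.iff_projective P₀).1 inferInstance
  have p₁ : Projective (ModuleCat.of A P₁) := (IsProjective.iff_projective P₁).1 inferInstance
  have p₂ : Projective (ModuleCat.of A (LinearMap.ker d')) :=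
    (IsProjective.iff_projective _).1 inferInstance
  have q : HasProjectiveDimensionLT (ModuleCat.of A (LinearMap.ker d₀)) 2 :=
    (kernelComplex_shortExact d' hd').hasProjectiveDimensionLT_X₃ 1
      (inferInstanceAs (HasProjectiveDimensionLT (ModuleCat.of A (LinearMap.ker d')) 1))
      (inferInstanceAs (HasProjectiveDimensionLT (ModuleCat.of A P₁) (1 + 1)))
  exact (kernelComplex_shortExact d₀ h₀).hasProjectiveDimensionLT_X₃ 2 q
      (inferInstanceAs (HasProjectiveDimensionLT (ModuleCat.of A P₀) (1 + 2)))

end Homological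

section Koszul

open TensorProduct

variable {K : Type u} [Field K] {A : Type u} [Ring A] [Algebra K A] {g : ℕ}

/-- `A` is generated by `x^1, …, x^g` subject to the only relation `∑ B μ ν • x^μ x^ν = 0`; the
latter is expressed by the possibility of defining linear maps on `A` by recursion. -/
structure IsQuadraticPresentation (B : Fin g → Fin g → K) (x : Fin g → A) : Prop where
  adjoin_eq_top : Algebra.adjoin K (Set.range x) = ⊤
  relation : ∑ μ, ∑ ν, B μ ν • (x μ * x ν) = 0
  exists_linearMap : ∀ {P : Type u} [AddCommGroup P] [Module K P] (r : Fin g → A × P →ₗ[K] P),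
    (∀ a p, ∑ μ, ∑ ν, B μ ν • r ν (a * x μ, r μ (a, p)) = 0) →
      ∃ D : A →ₗ[K] P, ∀ a μ, D (a * x μ) = r μ (a, D a)

variable (M : Type u) [AddCommGroup M] [Module K M]

/-- The endomorphism `a ⊗ m ↦ a * y ⊗ m` of `A ⊗ M`. -/
def innerMul (y : A) : A ⊗[K] M →ₗ[A] A ⊗[K] M :=
  AlgebraTensorModule.map (LinearMap.toSpanSingleton A A y) LinearMap.id

@[simp]
theorem innerMul_tmul (y a : A) (m : M) : innerMul M y (a ⊗ₜ[K] m) = (a * y) ⊗ₜ m := rfl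

variable {𝒜 : ℕ → Submodule K A} [GradedAlgebra 𝒜]

theorem innerMul_injective {y : A}
    (h : Function.Injective (LinearMap.mulRight K y)) :
    Function.Injective (innerMul (K := K) M y) := by
  have h' := Module.Flat.rTensor_preserves_injective_linearMap (M := M) _ h
  have : ⇑(innerMul (K := K) M y) = (LinearMap.mulRight K y).rTensor M := by
    funext u
    induction u using TensorProduct.induction_on with
    | zero => simp
    | add u v hu hv => simp only [map_add, hu, hv]
    | tmul a m => simp
  rwa [this]

variable (𝒜) in
theorem exists_sum_rTensor_proj (u : A ⊗[K] M) : ∃ N, ∀ n, N ≤ n →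
    u = ∑ i ∈ Finset.range n, (GradedAlgebra.proj 𝒜 i).rTensor M u := by
  induction u using TensorProduct.induction_on with
  | zero => exact ⟨0, by simp⟩
  | add u v hu hv =>
    obtain ⟨N, hN⟩ := hu
    obtain ⟨N', hN'⟩ := hv
    refine ⟨max N N', fun n hn => ?_⟩
    simp only [map_add, Finset.sum_add_distrib]
    rw [← hN n (le_of_max_le_left hn), ← hN' n (le_of_max_le_right hn)]
  | tmul a m =>
    obtain ⟨N, hN⟩ := exists_eq_sum_proj 𝒜 a
    exact ⟨N, fun n hn => by simp only [LinearMap.rTensor_tmul, ← sum_tmul, ← hN n hn]⟩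

theorem rTensor_proj_innerMul {y : A} (hy : y ∈ 𝒜 1) (n : ℕ)
    (u : A ⊗[K] M) :
    (GradedAlgebra.proj 𝒜 (n + 1)).rTensor M (innerMul M y u) =
      innerMul M y ((GradedAlgebra.proj 𝒜 n).rTensor M u) := by
  induction u using TensorProduct.induction_on with
  | zero => simp
  | add u v hu hv => simp only [map_add, hu, hv]
  | tmul a m => simp [proj_succ_mul 𝒜 hy]

variable [Module A M] [IsScalarTower K A M]

/-- The endomorphism `a ⊗ m ↦ a ⊗ y • m` of `A ⊗ M`. -/
def innerSMul (y : A) : A ⊗[K] M →ₗ[A] A ⊗[K] M :=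
  AlgebraTensorModule.map LinearMap.id (Algebra.lsmul K K M y)

@[simp]
theorem innerSMul_tmul (y a : A) (m : M) : innerSMul M y (a ⊗ₜ[K] m) = a ⊗ₜ (y • m) := rfl

/-- The augmentation `a ⊗ m ↦ a • m` of the Koszul resolution of `M`. -/
def koszulZero : A ⊗[K] M →ₗ[A] M :=
  AlgebraTensorModule.lift (LinearMap.toSpanSingleton A (M →ₗ[K] M) LinearMap.id)

@[simp]
theorem koszulZero_tmul (a : A) (m : M) : koszulZero M (a ⊗ₜ[K] m) = a • m := rfl

variable (B : Fin g → Fin g → K) (x : Fin g → A)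

/-- The element `∑ B μ ν • x^μ`. -/
def leftSum (ν : Fin g) : A := ∑ μ, B μ ν • x μ

/-- The element `∑ B μ ν • x^ν`. -/
def rightSum (μ : Fin g) : A := ∑ ν, B μ ν • x ν

/-- The first differential of the Koszul resolution of `M`. -/
def koszulOne : (Fin g → A ⊗[K] M) →ₗ[A] A ⊗[K] M :=
  ∑ μ, (innerMul M (x μ) - innerSMul M (x μ)) ∘ₗ LinearMap.proj μ

/-- The second differential of the Koszul resolution of `M`. -/
def koszulTwo : A ⊗[K] M →ₗ[A] (Fin g → A ⊗[K] M) :=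
  LinearMap.pi fun ν => innerMul M (leftSum B x ν) + innerSMul M (rightSum B x ν)

theorem koszulOne_apply (u : Fin g → A ⊗[K] M) : koszulOne M x u =
    ∑ μ, (innerMul M (x μ) (u μ) - innerSMul M (x μ) (u μ)) := by
  simp [koszulOne]

theorem koszulTwo_apply (u : A ⊗[K] M) (ν : Fin g) : koszulTwo M B x u ν =
    innerMul M (leftSum B x ν) u + innerSMul M (rightSum B x ν) u := rfl

theorem koszulOne_single (μ : Fin g) (u : A ⊗[K] M) :
    koszulOne M x (Pi.single μ u) = innerMul M (x μ) u - innerSMul M (x μ) u := by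
  rw [koszulOne_apply, Finset.sum_eq_single μ]
  · simp
  · intro ν _ hν; simp [hν]
  · simp

theorem koszulZero_surjective : Function.Surjective (koszulZero (K := K) (A := A) M) := fun m =>
  ⟨1 ⊗ₜ m, by simp⟩

/-- Modulo the image, $a\otimes m\equiv 1\otimes am$: this holds for generators and propagates along
sums and products. -/
theorem range_koszulOne (hx : Algebra.adjoin K (Set.range x) = ⊤) :
    LinearMap.range (koszulOne (K := K) M x) =
      LinearMap.ker (koszulZero (K := K) M) := by
  apply le_antisymm
  · rintro _ ⟨u, rfl⟩
    rw [LinearMap.mem_ker, koszulOne_apply, map_sum]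
    refine Finset.sum_eq_zero fun μ _ => ?_
    induction u μ using TensorProduct.induction_on with
    | zero => simp
    | tmul a m => simp [mul_smul]
    | add u v hu hv => rw [map_add, map_add, add_sub_add_comm, map_add, hu, hv, add_zero]
  · have key : ∀ (a : A) (m : M),
        a ⊗ₜ[K] m - 1 ⊗ₜ[K] (a • m) ∈ LinearMap.range (koszulOne M x) := fun a => by
      have ha : a ∈ Algebra.adjoin K (Set.range x) := hx ▸ Algebra.mem_top
      induction ha using Algebra.adjoin_induction with
      | mem y hy =>
        obtain ⟨μ, rfl⟩ := hy
        intro m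
        exact ⟨Pi.single μ (1 ⊗ₜ m), by simp [koszulOne_single]⟩
      | algebraMap c =>
        intro m
        rw [algebraMap_smul, ← smul_tmul, Algebra.algebraMap_eq_smul_one, sub_self]
        exact zero_mem _
      | add a c _ _ iha ihc =>
        intro m
        rw [add_smul, add_tmul, tmul_add, add_sub_add_comm]
        exact add_mem (iha m) (ihc m)
      | mul a c _ _ iha ihc =>
        intro m
        have h := Submodule.smul_mem _ a (ihc m)
        have h' := add_mem h (iha (c • m))
        rwa [smul_sub, smul_tmul', smul_tmul', smul_eq_mul, smul_eq_mul, mul_one, sub_add_sub_cancel,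
          smul_smul] at h'
    have key' : ∀ u : A ⊗[K] M,
        u - 1 ⊗ₜ[K] koszulZero M u ∈ LinearMap.range (koszulOne M x) := fun u => by
      induction u using TensorProduct.induction_on with
      | zero => simp
      | tmul a m => exact key a m
      | add u v hu hv =>
        rw [map_add, tmul_add, add_sub_add_comm]
        exact add_mem hu hv
    intro u hu
    have := key' u
    rwa [LinearMap.mem_ker.1 hu, tmul_zero, sub_zero] at this

variable {B x} in
theorem sum_leftSum_mul (h : ∑ μ, ∑ ν, B μ ν • (x μ * x ν) = 0) :
    ∑ ν, leftSum B x ν * x ν = 0 := by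
  rw [← h, Finset.sum_comm]
  simp [leftSum, Finset.sum_mul]

variable {B x} in
theorem sum_mul_rightSum (h : ∑ μ, ∑ ν, B μ ν • (x μ * x ν) = 0) :
    ∑ μ, x μ * rightSum B x μ = 0 := by
  rw [← h]
  simp [rightSum, Finset.mul_sum]

variable {B x}

theorem koszulOne_koszulTwo (hrel : ∑ μ, ∑ ν, B μ ν • (x μ * x ν) = 0) (u : A ⊗[K] M) :
    koszulOne M x (koszulTwo M B x u) = 0 := by
  induction u using TensorProduct.induction_on with
  | zero => simp
  | add u v hu hv => rw [map_add, map_add, hu, hv, add_zero]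
  | tmul a m =>
    simp only [koszulOne_apply, koszulTwo_apply, innerMul_tmul, innerSMul_tmul, map_add]
    have h₁ : ∑ ν, (a * leftSum B x ν * x ν) ⊗ₜ[K] m = 0 := by
      rw [← sum_tmul]
      simp only [mul_assoc, ← Finset.mul_sum, sum_leftSum_mul hrel, mul_zero, zero_tmul]
    have h₂ : ∑ ν, a ⊗ₜ[K] (x ν • rightSum B x ν • m) = 0 := by
      rw [← tmul_sum]
      simp only [smul_smul, ← Finset.sum_smul, sum_mul_rightSum hrel, zero_smul, tmul_zero]
    have h₃ : ∑ ν, (a * leftSum B x ν) ⊗ₜ[K] (x ν • m) =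
        ∑ ν, (a * x ν) ⊗ₜ[K] (rightSum B x ν • m) := by
      simp only [leftSum, rightSum, Finset.mul_sum, Finset.sum_smul, sum_tmul, tmul_sum,
        mul_smul_comm, smul_assoc, ← smul_tmul', tmul_smul]
      exact Finset.sum_comm
    simp only [Finset.sum_sub_distrib, Finset.sum_add_distrib, h₁, h₂, h₃]
    abel

/-- A retraction modulo the image $S$ of `koszulTwo`: define $D:A\to\mathrm{Hom}_K(M,(A\otimes
M)^g/S)$ by $D(ax^\mu)(m)=[(a\otimes m)e_\mu]+D(a)(x^\mu m)$. On the relator the bracketed terms add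
up to the class of `koszulTwo` of $a\otimes m$, and the rest vanishes by the relation in $M$. The
map $A\otimes M\to(A\otimes M)^g/S$ given by $D$, composed with `koszulOne`, is the quotient map, so
the kernel of `koszulOne` lies in $S$. -/
theorem range_koszulTwo (hA : IsQuadraticPresentation B x) :
    LinearMap.range (koszulTwo M B x) = LinearMap.ker (koszulOne M x) := by
  apply le_antisymm
  · rintro _ ⟨u, rfl⟩
    exact koszulOne_koszulTwo M hA.relation u
  let S := (LinearMap.range (koszulTwo M B x)).restrictScalars K
  let ι : Fin g → A ⊗[K] M →ₗ[K] (Fin g → A ⊗[K] M) ⧸ S :=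
    fun μ => S.mkQ ∘ₗ LinearMap.single K (fun _ => A ⊗[K] M) μ
  have hι : ∀ u : Fin g → A ⊗[K] M, ∑ μ, ι μ (u μ) = S.mkQ u := fun u => by
    change ∑ μ, S.mkQ (Pi.single μ (u μ)) = _
    rw [← map_sum, Finset.univ_sum_single]
  obtain ⟨D, hD⟩ := hA.exists_linearMap (P := M →ₗ[K] (Fin g → A ⊗[K] M) ⧸ S)
    (fun μ => (TensorProduct.mk K A M).compr₂ (ι μ) ∘ₗ LinearMap.fst K _ _ +
      LinearMap.lcomp K _ (Algebra.lsmul K K M (x μ)) ∘ₗ LinearMap.snd K _ _) (by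
    intro a f
    ext m
    simp only [LinearMap.sum_apply, LinearMap.smul_apply]
    change ∑ μ, ∑ ν, B μ ν • (ι ν ((a * x μ) ⊗ₜ m) +
      (ι μ (a ⊗ₜ (x ν • m)) + f (x μ • x ν • m))) = 0
    have h₁ : ∑ μ, ∑ ν, B μ ν • f (x μ • x ν • m) = 0 := by
      simp only [← map_smul, ← map_sum, smul_smul, ← smul_assoc, ← Finset.sum_smul]
      rw [hA.relation, zero_smul, map_zero]
    have h₂ : ∑ μ, ∑ ν, B μ ν • ι ν ((a * x μ) ⊗ₜ m) =
        ∑ ν, ι ν (innerMul M (leftSum B x ν) (a ⊗ₜ m)) := by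
      rw [Finset.sum_comm]
      simp only [← map_smul, ← map_sum, smul_tmul', ← sum_tmul, ← mul_smul_comm, ← Finset.mul_sum]
      rfl
    have h₃ : ∑ μ, ∑ ν, B μ ν • ι μ (a ⊗ₜ (x ν • m)) =
        ∑ μ, ι μ (innerSMul M (rightSum B x μ) (a ⊗ₜ m)) := by
      simp only [← map_smul, ← map_sum, ← tmul_smul, ← tmul_sum, ← smul_assoc, ← Finset.sum_smul]
      rfl
    simp only [smul_add, Finset.sum_add_distrib, h₁, h₂, h₃, add_zero]
    rw [← Finset.sum_add_distrib]
    simp only [← map_add, ← koszulTwo_apply, hι]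
    exact (Submodule.Quotient.mk_eq_zero S).2 ⟨_, rfl⟩)
  have hD' : ∀ u, TensorProduct.lift D (koszulOne M x u) = S.mkQ u := fun u => by
    rw [← hι, koszulOne_apply, map_sum]
    refine Finset.sum_congr rfl fun μ _ => ?_
    induction u μ using TensorProduct.induction_on with
    | zero => simp
    | add u v hu hv => rw [map_add, map_add, add_sub_add_comm, map_add, hu, hv, map_add]
    | tmul a m =>
      rw [innerMul_tmul, innerSMul_tmul, map_sub, lift.tmul, lift.tmul, hD]
      exact add_sub_cancel_right (ι μ (a ⊗ₜ m)) (D a (x μ • m))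
  intro u hu
  have := hD' u
  rw [LinearMap.mem_ker.1 hu, map_zero] at this
  exact (Submodule.Quotient.mk_eq_zero S).1 this.symm

variable (𝒜) in
theorem rTensor_proj_innerSMul (y : A) (n : ℕ) (u : A ⊗[K] M) :
    (GradedAlgebra.proj 𝒜 n).rTensor M (innerSMul M y u) =
      innerSMul M y ((GradedAlgebra.proj 𝒜 n).rTensor M u) := by
  induction u using TensorProduct.induction_on with
  | zero => simp
  | add u v hu hv => simp only [map_add, hu, hv]
  | tmul a m => simp

variable (𝒜) in
-- Only the first tensor factor is graded. There `innerMul` raises the degree by one and `innerSMul`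
-- preserves it, so the degree $n+1$ part of one coordinate reads $f_\nu$-multiple of $u_n$ plus a
-- term in $u_{n+1}$. Components therefore vanish by descent from the top degree.
theorem koszulTwo_injective (hx1 : ∀ μ, x μ ∈ 𝒜 1) (ν : Fin g)
    (h : Function.Injective (LinearMap.mulRight K (leftSum B x ν))) :
    Function.Injective (koszulTwo M B x) := by
  rw [injective_iff_map_eq_zero]
  intro u hu
  have hν : leftSum B x ν ∈ 𝒜 1 := sum_mem fun μ _ => Submodule.smul_mem _ _ (hx1 μ)
  let q : ℕ → A ⊗[K] M := fun n => (GradedAlgebra.proj 𝒜 n).rTensor M u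
  have step : ∀ n, q (n + 1) = 0 → q n = 0 := fun n hn => by
    have h' := congrArg ((GradedAlgebra.proj 𝒜 (n + 1)).rTensor M) (congrFun hu ν)
    rw [koszulTwo_apply, map_add, rTensor_proj_innerMul M hν,
      rTensor_proj_innerSMul] at h'
    change innerMul M (leftSum B x ν) (q n) + innerSMul M (rightSum B x ν) (q (n + 1)) = _ at h'
    rw [hn, map_zero, add_zero, Pi.zero_apply, map_zero] at h'
    exact innerMul_injective M h (h'.trans (map_zero _).symm)
  obtain ⟨N, hN⟩ := exists_sum_rTensor_proj M 𝒜 u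
  have hNq : q N = 0 := by
    have h := hN (N + 1) (Nat.le_succ N)
    rw [Finset.sum_range_succ, ← hN N le_rfl] at h
    exact left_eq_add.1 h
  have hq : ∀ k n, n + k = N → q n = 0 := by
    intro k
    induction k with
    | zero => rintro n rfl; exact hNq
    | succ k ih => exact fun n hn => step n (ih (n + 1) (by omega))
  rw [hN N le_rfl]
  exact Finset.sum_eq_zero fun i hi => hq (N - i) i (by have := Finset.mem_range.1 hi; omega)

theorem hasProjectiveDimensionLT_three_of_presentation (hA : IsQuadraticPresentation B x)
    (𝒜 : ℕ → Submodule K A) [GradedAlgebra 𝒜] (hx1 : ∀ μ, x μ ∈ 𝒜 1) (ν : Fin g)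
    (h : Function.Injective (LinearMap.mulRight K (leftSum B x ν))) (M : ModuleCat.{u} A) :
    HasProjectiveDimensionLT M 3 := by
  let _ : Module K M := Module.compHom M (algebraMap K A)
  have : IsScalarTower K A M := ⟨fun c a m => by rw [Algebra.smul_def, mul_smul]; rfl⟩
  exact hasProjectiveDimensionLT_three_of_resolution (koszulZero (K := K) M) (koszulOne M x)
    (koszulTwo M B x) (koszulZero_surjective M) (range_koszulOne M x hA.adjoin_eq_top)
    (range_koszulTwo M hA) (koszulTwo_injective M 𝒜 hx1 ν h)

end Koszul

namespace QuadAlg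

variable {K : Type u} [Field K] {g : ℕ} {b : LinearMap.BilinForm K (Fin g → K)}

theorem isQuadraticPresentation : IsQuadraticPresentation (comp b) (gen b) :=
  ⟨adjoin_gen b, relation b, fun r hr => exists_linearMap_mul_gen b r hr⟩

theorem hasProjectiveDimensionLT_three (hg : 2 ≤ g) (hb : b.Nondegenerate)
    (M : ModuleCat.{u} (QuadAlg b)) : HasProjectiveDimensionLT M 3 := by
  refine hasProjectiveDimensionLT_three_of_presentation isQuadraticPresentation (grading b)
    (gen_mem b) ⟨0, by omega⟩ ?_ M
  rw [injective_iff_map_eq_zero]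
  exact fun a ha => eq_zero_of_mul_leftPart hg hb _ ha

end QuadAlg

theorem exists_addEquiv_of_surjective {G H L : Type*} [AddGroup G] [AddGroup H] [AddGroup L]
    (δ : G →+ H) (κ : G →+ L) (hδ : Function.Surjective δ) (hκ : Function.Surjective κ)
    (h : ∀ x, δ x = 0 ↔ κ x = 0) : ∃ e : H ≃+ L, ∀ x, e (δ x) = κ x := by
  have hker : δ.ker = κ.ker := AddSubgroup.ext h
  refine ⟨(QuotientAddGroup.quotientKerEquivOfSurjective δ hδ).symm.trans
    ((QuotientAddGroup.quotientAddEquivOfEq hker).trans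
      (QuotientAddGroup.quotientKerEquivOfSurjective κ hκ)), fun x => ?_⟩
  have : (QuotientAddGroup.quotientKerEquivOfSurjective δ hδ).symm (δ x) = (x : G ⧸ δ.ker) := by
    rw [AddEquiv.symm_apply_eq]; rfl
  rw [AddEquiv.trans_apply, this]
  rfl

/-! ### The Gorenstein property from the dual complex. -/

section Gorenstein

variable {K : Type u} [Field K] {A : Type u} [Ring A] [Algebra K A] {g : ℕ}

/-- The properties of the presentation of a quadratic algebra, with relation `∑ B μ ν x^μ x^ν`,
from which the Gorenstein property in dimension two follows. -/
structure IsKoszulPresentation (𝒜 : ℕ → Submodule K A) (B : Matrix (Fin g) (Fin g) K)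
    (x : Fin g → A) : Prop where
  nonempty : Nonempty (Fin g)
  mem_one : ∀ μ, x μ ∈ 𝒜 1
  adjoin_eq_top : Algebra.adjoin K (Set.range x) = ⊤
  isUnit : IsUnit B
  relation : ∑ μ, ∑ ν, B μ ν • (x μ * x ν) = 0
  exists_eq_mul_leftSum : ∀ v : Fin g → A, ∑ ν, v ν * x ν = 0 → ∃ t, ∀ ν, v ν = t * leftSum B x ν
  exists_eq_rightSum_mul : ∀ v : Fin g → A, ∑ μ, x μ * v μ = 0 → ∃ u, ∀ μ, v μ = rightSum B x μ * u
  eq_zero_of_mul_leftSum : ∀ (a : A) ν, a * leftSum B x ν = 0 → a = 0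
  eq_zero_of_mul : ∀ (a : A) μ, x μ * a = 0 → a = 0

theorem sum_inverse_smul_leftSum {B C : Matrix (Fin g) (Fin g) K} (hC : B * C = 1) (x : Fin g → A)
    (μ : Fin g) : ∑ ν, C ν μ • leftSum B x ν = x μ := by
  simp only [leftSum, Finset.smul_sum, smul_smul]
  rw [Finset.sum_comm]
  have h : ∀ i, ∑ ν, C ν μ * B i ν = if i = μ then 1 else 0 := fun i => by
    rw [← Matrix.one_apply, ← hC, Matrix.mul_apply]
    exact Finset.sum_congr rfl fun _ _ => mul_comm _ _
  simp [← Finset.sum_smul, h]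

theorem eq_zero_of_sum_smul_eq_zero {B : Matrix (Fin g) (Fin g) K} (hB : IsUnit B) {M : Type*}
    [AddCommGroup M] [Module K M] {v : Fin g → M} (h : ∀ μ, ∑ ν, B μ ν • v ν = 0) : v = 0 := by
  obtain ⟨C, hC⟩ := hB.exists_left_inv
  funext l
  have h' : ∑ μ, C l μ • ∑ ν, B μ ν • v ν = v l := by
    simp only [Finset.smul_sum, smul_smul]
    rw [Finset.sum_comm]
    have h : ∀ i, ∑ μ, C l μ * B μ i = if l = i then 1 else 0 := fun i => by
      rw [← Matrix.one_apply, ← hC, Matrix.mul_apply]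
    simp [← Finset.sum_smul, h]
  rw [← h']
  exact Finset.sum_eq_zero fun μ _ => by rw [h, smul_zero]

theorem linearMap_pi_apply {A : Type*} [Ring A] (ψ : (Fin g → A) →ₗ[A] A) (v : Fin g → A) :
    ψ v = ∑ ν, v ν * ψ (Pi.single ν 1) := by
  conv_lhs => rw [pi_eq_sum_univ' v, map_sum]
  simp

namespace IsKoszulPresentation

variable {𝒜 : ℕ → Submodule K A} {B : Matrix (Fin g) (Fin g) K}
  {x : Fin g → A} (hA : IsKoszulPresentation 𝒜 B x)

include hA

theorem leftSum_mem (ν : Fin g) : leftSum B x ν ∈ 𝒜 1 :=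
  sum_mem fun μ _ => Submodule.smul_mem _ _ (hA.mem_one μ)

variable [GradedAlgebra 𝒜] [IsConnectedGraded 𝒜] {N : Type u} [AddCommGroup N] [Module A N]
  {ε : A →ₗ[A] N} (hε : IsAugmentation 𝒜 ε)

include hε

/-- Each $x^i$ annihilates $N$, so it annihilates on the left the values of any homomorphism $N\to
A$; left multiplication by $x^i$ is injective. -/
theorem ext_zero :
    Subsingleton (Ext (ModuleCat.of A N) (ModuleCat.of A A) 0) := by
  refine subsingleton_ext_zero  fun f => LinearMap.ext fun c => ?_
  obtain ⟨i⟩ := hA.nonempty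
  refine hA.eq_zero_of_mul _ i ?_
  obtain ⟨a, rfl⟩ := hε.surjective c
  rw [← smul_eq_mul, ← map_smul, ← map_smul]
  have : ε (x i • a) = 0 := by
    rw [hε.eq_zero_iff, smul_eq_mul, map_mul, augmentation_of_mem_one (hA.mem_one i), zero_mul]
  rw [this, map_zero]

/-- Put $y_\nu=\varphi(x^\nu)$. The relation gives $\sum_\mu x^\mu\sum_\nu B_{\mu\nu}y_\nu=0$, so
$\sum_\nu B_{\mu\nu}y_\nu=\sum_\nu B_{\mu\nu}x^\nu u$ by the exactness for right modules. Cancelling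
$B$ yields $y_\nu=x^\nu u$: the functional is right multiplication by $u$. -/
theorem ext_one :
    Subsingleton (Ext (ModuleCat.of A N) (ModuleCat.of A A) 1) := by
  refine subsingleton_ext_one  ε hε.surjective
   fun φ => ?_
  let X : Fin g → LinearMap.ker ε := fun μ =>
    ⟨x μ, (hε.eq_zero_iff _).2 (augmentation_of_mem_one (hA.mem_one μ))⟩
  have h₁ : ∑ ν, leftSum B x ν * φ (X ν) = 0 := by
    simp only [← smul_eq_mul, ← map_smul, ← map_sum]
    rw [← map_zero φ]
    congr 1
    apply Subtype.ext
    simpa [X] using sum_leftSum_mul hA.relation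
  have h₂ : ∑ μ, x μ * ∑ ν, B μ ν • φ (X ν) = 0 := by
    rw [← h₁]
    simp only [leftSum, Finset.mul_sum, Finset.sum_mul, mul_smul_comm, smul_mul_assoc]
    exact Finset.sum_comm
  obtain ⟨u, hu⟩ := hA.exists_eq_rightSum_mul _ h₂
  have h₃ : (fun ν => φ (X ν) - x ν * u) = 0 := by
    apply eq_zero_of_sum_smul_eq_zero hA.isUnit
    intro μ
    simp only [smul_sub, Finset.sum_sub_distrib, hu, rightSum, Finset.sum_mul, smul_mul_assoc,
      sub_self]
  refine ⟨LinearMap.toSpanSingleton _ _ u, LinearMap.ext fun ⟨a, ha⟩ => ?_⟩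
  obtain ⟨v, rfl⟩ := (hε.range_linearCombination_eq_ker hA.mem_one hA.adjoin_eq_top) ▸ ha
  have h₄ : (⟨_, ha⟩ : LinearMap.ker ε) = ∑ ν, v ν • X ν := by
    apply Subtype.ext
    simp [X, Fintype.linearCombination_apply]
  rw [h₄, map_sum, map_sum]
  refine Finset.sum_congr rfl fun ν _ => ?_
  rw [map_smul, map_smul]
  congr 1
  exact sub_eq_zero.1 (congrFun h₃ ν)

/-- The syzygy module is free on $f=$ `leftSum`, so $\varphi\mapsto\varphi(f)$ identifies its dual
with $A$. Functionals restricted from $A^g$ become the right ideal generated by the $f_\nu$, which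
is $A_+$ since $B$ is invertible; the quotient is $K$. -/
theorem ext_two :
    ∃ e : Ext (ModuleCat.of A N) (ModuleCat.of A A) 2 ≃+ K,
      ∀ ξ a, e (extRightAction ξ a) = e ξ * augmentation 𝒜 a := by
  let d := Fintype.linearCombination A x
  obtain ⟨δ, hδ, hδ0, hδa⟩ := exists_ext_two_presentation
     ε
    hε.surjective d (hε.range_linearCombination_eq_ker hA.mem_one hA.adjoin_eq_top)
  let f : LinearMap.ker d := ⟨leftSum B x, sum_leftSum_mul hA.relation⟩
  let κ : (LinearMap.ker d →ₗ[A] A) →+ K :=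
    { toFun := fun φ => augmentation 𝒜 (φ f)
      map_zero' := map_zero (augmentation 𝒜)
      map_add' := fun φ ψ => map_add (augmentation 𝒜) _ _ }
  have hf : Function.Bijective (LinearMap.toSpanSingleton A (LinearMap.ker d) f) := by
    constructor
    · rw [injective_iff_map_eq_zero]
      intro a ha
      obtain ⟨i⟩ := hA.nonempty
      exact hA.eq_zero_of_mul_leftSum _ i (congrFun (congrArg Subtype.val ha) i)
    · rintro ⟨v, hv⟩
      obtain ⟨t, ht⟩ := hA.exists_eq_mul_leftSum v hv
      exact ⟨t, Subtype.ext (funext fun ν => (ht ν).symm)⟩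
  let E := LinearEquiv.ofBijective _ hf
  have hE : E.symm f = 1 := by
    rw [LinearEquiv.symm_apply_eq]
    exact (one_smul A f).symm
  have hκ : Function.Surjective κ := fun c =>
    ⟨LinearMap.toSpanSingleton _ _ (algebraMap K A c) ∘ₗ E.symm.toLinearMap, by
      change augmentation 𝒜 (E.symm f * algebraMap K A c) = c
      rw [hE, one_mul, augmentation_algebraMap]⟩
  have hδκ : ∀ φ, δ φ = 0 ↔ κ φ = 0 := fun φ => by
    rw [hδ0]
    change _ ↔ augmentation 𝒜 (φ f) = 0
    constructor
    · rintro ⟨ψ, rfl⟩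
      change augmentation 𝒜 (ψ (leftSum B x)) = 0
      rw [linearMap_pi_apply, map_sum]
      exact Finset.sum_eq_zero fun ν _ => by
        rw [map_mul, augmentation_of_mem_one (hA.leftSum_mem ν), zero_mul]
    · intro h
      obtain ⟨c, w, hw⟩ := exists_eq_algebraMap_add_mul_sum hA.adjoin_eq_top (φ f)
      have hc : c = 0 := by
        rw [hw, map_add, augmentation_algebraMap, map_sum] at h
        simpa [augmentation_of_mem_one (hA.mem_one _)] using h
      -- Since $x^\mu=\sum_\nu C_{\nu\mu}f_\nu$, the expansion of $\varphi(f)$ in the $x^\mu$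
      -- becomes one in the $f_\nu$, whose coefficients define the extension to $A^g$.
      obtain ⟨C, hC⟩ := hA.isUnit.exists_right_inv
      refine ⟨Fintype.linearCombination _ fun ν => ∑ μ, C ν μ • w μ, ?_⟩
      have : φ f = Fintype.linearCombination A (fun ν => ∑ μ, C ν μ • w μ)
          (leftSum B x) := by
        rw [hw, hc, map_zero, zero_add, Fintype.linearCombination_apply]
        simp only [← sum_inverse_smul_leftSum hC x, Finset.sum_mul, smul_mul_assoc, smul_eq_mul,
          Finset.mul_sum, mul_smul_comm]
        exact Finset.sum_comm
      refine LinearMap.ext fun ω => ?_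
      obtain ⟨t, rfl⟩ := hf.2 ω
      change φ (t • f) = Fintype.linearCombination A _ (t • leftSum B x)
      rw [map_smul, map_smul, this]
  obtain ⟨e, he⟩ := exists_addEquiv_of_surjective δ κ hδ hκ hδκ
  refine ⟨e, fun ξ a => ?_⟩
  obtain ⟨φ, rfl⟩ := hδ ξ
  have h := he (LinearMap.toSpanSingleton _ _ a ∘ₗ φ)
  rw [hδa] at h
  refine h.trans ?_
  rw [he]
  exact map_mul (augmentation 𝒜) _ _

end IsKoszulPresentation

end Gorenstein

/-! ### Regularity of the algebra of a nondegenerate form. -/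

namespace QuadAlg

variable {K : Type u} [Field K] {g : ℕ} {b : LinearMap.BilinForm K (Fin g → K)}

theorem isUnit_comp (hb : b.Nondegenerate) : IsUnit (Matrix.of (comp b)) := by
  rw [← Matrix.mulVec_injective_iff_isUnit]
  refine (injective_iff_map_eq_zero (Matrix.mulVecLin (Matrix.of (comp b)))).2 fun c hc => ?_
  by_contra hc0
  refine apply_single_left_ne_zero hb hc0 ?_
  rw [← hc]
  funext μ
  rw [← sum_comp_mul]
  rfl

theorem isKoszulPresentation (hg : 2 ≤ g) (hb : b.Nondegenerate) :
    IsKoszulPresentation (grading b) (Matrix.of (comp b)) (gen b) where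
  nonempty := ⟨⟨0, by omega⟩⟩
  mem_one := gen_mem b
  adjoin_eq_top := adjoin_gen b
  isUnit := isUnit_comp hb
  relation := relation b
  exists_eq_mul_leftSum _ hv := exists_eq_mul_leftPart b hv
  exists_eq_rightSum_mul _ hv := exists_eq_rightPart_mul b hv
  eq_zero_of_mul_leftSum _ ν h := eq_zero_of_mul_leftPart hg hb ν h
  eq_zero_of_mul a μ h := eq_zero_of_linear_mul hg hb (c := Pi.single μ 1) (by simp) <| by
    rw [← h]
    congr 1
    simp [Pi.single_apply]

theorem isGrAlg (b : LinearMap.BilinForm K (Fin g → K)) : IsGrAlg (grading b) where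
  connected := inferInstance
  finite_degree_one := by
    rw [grading_one]
    exact Module.Finite.span_of_finite K (Set.finite_range _)
  generated := by
    rw [← AlgHom.range_eq_top, eq_top_iff, ← adjoin_gen b, Algebra.adjoin_le_iff]
    rintro _ ⟨μ, rfl⟩
    exact ⟨TensorAlgebra.ι K ⟨gen b μ, gen_mem b μ⟩, by simp [tensorToAlg]⟩
  presented := by
    classical
    let y : Fin g → TensorAlgebra K (grading b 1) :=
      fun μ => TensorAlgebra.ι K ⟨gen b μ, gen_mem b μ⟩
    have hy : ∀ μ, tensorToAlg (grading b) (y μ) = gen b μ := fun μ => by simp [tensorToAlg, y]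
    let r := ∑ μ, ∑ ν, comp b μ ν • (y μ * y ν)
    have hr : r ∈ TwoSidedIdeal.ker (tensorToAlg (grading b)) := by
      rw [TwoSidedIdeal.mem_ker]
      simp [r, hy, relation]
    refine ⟨{r}, fun f hf => ⟨2, le_rfl, ?_⟩, le_antisymm ?_ fun f hf => ?_⟩
    · rw [Finset.mem_singleton.1 hf, pow_two]
      exact sum_mem fun μ _ => sum_mem fun ν _ => Submodule.smul_mem _ _
        (Submodule.mul_mem_mul ⟨_, rfl⟩ ⟨_, rfl⟩)
    · rw [TwoSidedIdeal.span_le]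
      rintro f hf
      rw [Finset.mem_coe, Finset.mem_singleton] at hf
      exact hf ▸ hr
    -- The universal property gives a map $\psi$ from the quadratic algebra to $T/(r)$ whose
    -- composite with `tensorToAlg` is the projection $\pi$; hence the kernel lies in $(r)$.
    · let I := TwoSidedIdeal.span ((({r} : Finset _) : Set (TensorAlgebra K (grading b 1))))
      let π : TensorAlgebra K (grading b 1) →ₐ[K] I.ringCon.Quotient := I.ringCon.mkₐ K
      have hπ : ∀ t, π t = 0 ↔ t ∈ I := fun t => by
        rw [TwoSidedIdeal.mem_iff, ← RingCon.eq]; rfl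
      let ψ : QuadAlg b →ₐ[K] I.ringCon.Quotient := liftHom b (fun μ => π (y μ)) (by
        have : π r = 0 := (hπ r).2 (TwoSidedIdeal.subset_span (by simp))
        simpa [r] using this)
      have hψ : ψ.comp (tensorToAlg (grading b)) = π := by
        apply TensorAlgebra.hom_ext
        ext ⟨e, he⟩
        have key : ∀ e (_ : e ∈ Submodule.span K (Set.range (gen b))) (he : e ∈ grading b 1),
            ψ e = π (TensorAlgebra.ι K ⟨e, he⟩) := fun e he' => by
          induction he' using Submodule.span_induction with
          | mem x hx =>
            obtain ⟨μ, rfl⟩ := hx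
            exact fun _ => liftHom_gen b _ _ μ
          | zero =>
            intro h
            rw [map_zero, show (⟨0, h⟩ : grading b 1) = 0 from rfl, map_zero, map_zero]
          | add u v hu hv ihu ihv =>
            rw [← grading_one] at hu hv
            intro h
            rw [map_add, ihu hu, ihv hv, ← map_add, ← map_add]; rfl
          | smul c u hu ihu =>
            rw [← grading_one] at hu
            intro h
            rw [map_smul, ihu hu, ← map_smul, ← map_smul]; rfl
        simpa [tensorToAlg] using key e (grading_one b ▸ he) he
      rw [TwoSidedIdeal.mem_ker] at hf
      rw [← hπ, ← hψ, AlgHom.comp_apply, hf, map_zero]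

theorem isGorenstein (hg : 2 ≤ g) (hb : b.Nondegenerate) : IsGorenstein (grading b) 2 where
  ext_eq_zero n hn := by
    match n with
    | 0 =>
      exact (isKoszulPresentation hg hb).ext_zero (N := trivialModule (grading b))
        (isAugmentation_augmentationHom (grading b))
    | 1 =>
      exact (isKoszulPresentation hg hb).ext_one (N := trivialModule (grading b))
        (isAugmentation_augmentationHom (grading b))
    | 2 => exact absurd rfl hn
    | n + 3 =>
      have := hasProjectiveDimensionLT_three hg hb (trivialModule (grading b))
      exact HasProjectiveDimensionLT.subsingleton _ 3 _ (by omega) _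
  ext_top := (isKoszulPresentation hg hb).ext_two (N := trivialModule (grading b))
        (isAugmentation_augmentationHom (grading b))

theorem isRegularOfDim_two (hg : 2 ≤ g) (hb : b.Nondegenerate) :
    IsRegularOfDim (grading b) 2 where
  grAlg := isGrAlg b
  globalDimension_eq := by
    apply le_antisymm
    · exact iSup_le fun M => (projectiveDimension_le_iff M 2).2
        (hasProjectiveDimensionLT_three hg hb M)
    -- The bound is attained by the trivial module, because its $\mathrm{Ext}^2$ into $A$ is $K\ne
    -- 0$.
    · refine le_trans ?_ (le_iSup (fun M : ModuleCat.{u} (QuadAlg b) => projectiveDimension M)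
        (trivialModule (grading b)))
      refine (projectiveDimension_ge_iff _ 2).2 fun h => ?_
      obtain ⟨e, -⟩ := (isKoszulPresentation hg hb).ext_two (N := trivialModule (grading b))
        (isAugmentation_augmentationHom (grading b))
      have := HasProjectiveDimensionLT.subsingleton (trivialModule (grading b)) 2 2 le_rfl
        (ModuleCat.of _ (QuadAlg b))
      exact one_ne_zero (e.symm.injective.subsingleton.elim (1 : K) 0)
  gorenstein := isGorenstein hg hb

end QuadAlg

/-! ### Graded isomorphisms and equivalence of forms up to a scalar. -/

namespace QuadAlg

variable {K : Type u} [Field K] {g g' : ℕ}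

theorem exists_sum_smul_gen_eq {b : LinearMap.BilinForm K (Fin g → K)} {a : QuadAlg b}
    (ha : a ∈ grading b 1) : ∃ c : Fin g → K, ∑ μ, c μ • gen b μ = a := by
  rw [grading_one] at ha
  exact (Submodule.mem_span_range_iff_exists_fun K).1 ha

/-- The quadratic relations between the generators are the multiples of the given one. -/
theorem exists_eq_mul_comp {b : LinearMap.BilinForm K (Fin g → K)} {C : Fin g → Fin g → K}
    (h : ∑ μ, ∑ ν, C μ ν • (gen b μ * gen b ν) = 0) : ∃ t, ∀ μ ν, C μ ν = t * comp b μ ν := by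
  have h' : ∑ ν, (∑ μ, C μ ν • gen b μ) * gen b ν = 0 := by
    rw [← h, Finset.sum_comm]
    simp only [Finset.sum_mul, smul_mul_assoc]
  obtain ⟨t, ht⟩ := exists_eq_mul_leftPart b h'
  -- In degree one only the scalar part of $t$ contributes, and the generators are linearly
  -- independent.
  refine ⟨augmentation (grading b) t, fun μ ν => ?_⟩
  have h₁ := congrArg (GradedAlgebra.proj (grading b) 1) (ht ν)
  rw [proj_of_mem _ (sum_smul_gen_mem _), proj_succ_mul _ (leftPart_mem ν) 0,
    ← algebraMap_augmentation, ← Algebra.smul_def, leftPart, Finset.smul_sum] at h₁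
  simp only [smul_smul] at h₁
  have h₂ := Fintype.linearIndependent_iff.1 (linearIndependent_gen b)
    (fun μ => C μ ν - augmentation (grading b) t * comp b μ ν)
    (by simp only [sub_smul, Finset.sum_sub_distrib, h₁, sub_self]) μ
  exact sub_eq_zero.1 h₂

/-- Substituting linear forms for the generators in the relator amounts to pulling the form back
along $M$. This formula serves both directions of the classification. -/
theorem sum_comp_smul_mul {A : Type*} [Semiring A] [Algebra K A]
    (b : LinearMap.BilinForm K (Fin g → K)) (M : (Fin g' → K) →ₗ[K] (Fin g → K)) (x : Fin g' → A) :
    ∑ l, ∑ r, comp b l r •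
      ((∑ μ, M (Pi.single μ 1) l • x μ) * ∑ ν, M (Pi.single ν 1) r • x ν) =
      ∑ μ, ∑ ν, b (M (Pi.single μ 1)) (M (Pi.single ν 1)) • (x μ * x ν) := by
  simp only [apply_eq_sum b (M _), Finset.sum_smul, Finset.sum_mul, Finset.mul_sum,
    Finset.smul_sum, smul_mul_assoc, mul_smul_comm, smul_smul]
  have e : ∀ F : Fin g → Fin g → Fin g' → Fin g' → A,
      ∑ l, ∑ r, ∑ μ, ∑ ν, F l r μ ν = ∑ μ, ∑ ν, ∑ l, ∑ r, F l r μ ν := fun F => by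
    exact (Finset.sum_congr rfl fun l _ => Finset.sum_comm).trans (Finset.sum_comm.trans
      (Finset.sum_congr rfl fun μ _ =>
        (Finset.sum_congr rfl fun l _ => Finset.sum_comm).trans Finset.sum_comm))
  rw [e, Finset.sum_comm]
  refine Finset.sum_congr rfl fun μ _ => Finset.sum_congr rfl fun ν _ =>
    Finset.sum_congr rfl fun l _ => Finset.sum_congr rfl fun r _ => ?_
  rw [mul_comm (M (Pi.single ν 1) r)]

/-- The algebra homomorphism induced by a linear map between the spaces dual to the spans of the
generators which respects the bilinear forms up to a scalar. -/
def substHom {b : LinearMap.BilinForm K (Fin g → K)} {b' : LinearMap.BilinForm K (Fin g' → K)}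
    (M : (Fin g' → K) →ₗ[K] (Fin g → K)) (c : K) (h : ∀ v w, b (M v) (M w) = c * b' v w) :
    QuadAlg b →ₐ[K] QuadAlg b' :=
  liftHom b (fun l => ∑ μ, M (Pi.single μ 1) l • gen b' μ) (by
    rw [sum_comp_smul_mul]
    simp only [h, mul_smul, ← Finset.smul_sum]
    exact (congrArg (c • ·) (relation b')).trans (smul_zero c))

theorem substHom_gen {b : LinearMap.BilinForm K (Fin g → K)}
    {b' : LinearMap.BilinForm K (Fin g' → K)} (M : (Fin g' → K) →ₗ[K] (Fin g → K)) (c : K)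
    (h : ∀ v w, b (M v) (M w) = c * b' v w) (l : Fin g) :
    substHom M c h (gen b l) = ∑ μ, M (Pi.single μ 1) l • gen b' μ :=
  liftHom_gen _ _ _ _

theorem substHom_comp {b : LinearMap.BilinForm K (Fin g → K)}
    {b' : LinearMap.BilinForm K (Fin g' → K)} (M : (Fin g' → K) →ₗ[K] (Fin g → K))
    (M' : (Fin g → K) →ₗ[K] (Fin g' → K)) (c c' : K)
    (h : ∀ v w, b (M v) (M w) = c * b' v w) (h' : ∀ v w, b' (M' v) (M' w) = c' * b v w)
    (hM : ∀ v, M (M' v) = v) :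
    (substHom M' c' h').comp (substHom M c h) = AlgHom.id K _ := by
  refine hom_ext fun l => ?_
  rw [AlgHom.comp_apply, substHom_gen, map_sum, AlgHom.id_apply]
  simp only [map_smul, substHom_gen, Finset.smul_sum, smul_smul]
  rw [Finset.sum_comm]
  have key : ∀ ν, ∑ μ, M (Pi.single μ 1) l * M' (Pi.single ν 1) μ =
      (Pi.single ν 1 : Fin g → K) l := fun ν => by
    conv_rhs => rw [← hM (Pi.single ν 1), pi_eq_sum_univ' (M' (Pi.single ν 1)), map_sum]
    simp [mul_comm]
  simp [← Finset.sum_smul, key, Pi.single_apply]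

theorem map_grading_le {b : LinearMap.BilinForm K (Fin g → K)}
    {b' : LinearMap.BilinForm K (Fin g' → K)} {f : QuadAlg b →ₐ[K] QuadAlg b'}
    (h : ∀ l, f (gen b l) ∈ grading b' 1) (n : ℕ) :
    (grading b n).map f.toLinearMap ≤ grading b' n := by
  change (Submodule.span K (Set.range (gen b)) ^ n).map f.toLinearMap ≤ _ ^ n
  rw [Submodule.map_pow, ← grading_one b']
  refine pow_le_pow_left' ?_ n
  rw [Submodule.map_span_le]
  rintro _ ⟨l, rfl⟩
  exact h l

theorem gradedIso_of_algEquiv {b : LinearMap.BilinForm K (Fin g → K)}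
    {b' : LinearMap.BilinForm K (Fin g' → K)} (e : QuadAlg b ≃ₐ[K] QuadAlg b')
    (h : ∀ l, e (gen b l) ∈ grading b' 1) (h' : ∀ l, e.symm (gen b' l) ∈ grading b 1) :
    GradedIso (grading b) (grading b') := by
  refine ⟨e, fun n => le_antisymm (map_grading_le (f := e.toAlgHom) h n) fun a ha => ?_⟩
  exact ⟨e.symm a, map_grading_le (f := e.symm.toAlgHom) h' n ⟨a, ha, rfl⟩, e.apply_symm_apply a⟩

theorem gradedIso_of_equiv {b b' : LinearMap.BilinForm K (Fin g → K)}
    (L : (Fin g → K) ≃ₗ[K] (Fin g → K)) {c : K} (hc : c ≠ 0)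
    (h : ∀ v w, b' v w = c * b (L v) (L w)) : GradedIso (grading b) (grading b') := by
  have h₁ : ∀ v w, b (L.toLinearMap v) (L.toLinearMap w) = c⁻¹ * b' v w := fun v w => by
    rw [h, inv_mul_cancel_left₀ hc]; rfl
  have h₂ : ∀ v w, b' (L.symm.toLinearMap v) (L.symm.toLinearMap w) = c * b v w := fun v w => by
    rw [h]; simp
  refine gradedIso_of_algEquiv (AlgEquiv.ofAlgHom (substHom _ _ h₁) (substHom _ _ h₂)
    (substHom_comp _ _ _ _ _ _ fun v => L.symm_apply_apply v)
    (substHom_comp _ _ _ _ _ _ fun v => L.apply_symm_apply v)) (fun l => ?_) fun l => ?_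
  · change substHom _ _ h₁ (gen b l) ∈ _
    rw [substHom_gen]; exact sum_smul_gen_mem _
  · change substHom _ _ h₂ (gen b' l) ∈ _
    rw [substHom_gen]; exact sum_smul_gen_mem _

theorem finrank_grading_one (b : LinearMap.BilinForm K (Fin g → K)) :
    Module.finrank K (grading b 1) = g := by
  rw [grading_one, finrank_span_eq_card (linearIndependent_gen b), Fintype.card_fin]

theorem eq_of_gradedIso {b : LinearMap.BilinForm K (Fin g → K)}
    {b' : LinearMap.BilinForm K (Fin g' → K)} (h : GradedIso (grading b) (grading b')) :
    g = g' := by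
  obtain ⟨e, he⟩ := h
  rw [← finrank_grading_one b, ← finrank_grading_one b', ← he 1]
  exact (LinearEquiv.finrank_map_eq e.toLinearEquiv (grading b 1)).symm

/-- The isomorphism is determined in degree one by an invertible matrix. The image of the relation
of $b$ is the quadratic relation of the pulled-back form, hence a multiple of $b'$. -/
theorem exists_equiv_of_gradedIso {b b' : LinearMap.BilinForm K (Fin g → K)} (hg : 2 ≤ g)
    (hb : b.Nondegenerate) (h : GradedIso (grading b) (grading b')) :
    ∃ (L : (Fin g → K) ≃ₗ[K] (Fin g → K)) (c : K), c ≠ 0 ∧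
      ∀ v w, b' v w = c * b (L v) (L w) := by
  obtain ⟨e, he⟩ := h
  have hmem : ∀ l, e (gen b l) ∈ grading b' 1 := fun l =>
    he 1 ▸ Submodule.mem_map_of_mem (gen_mem b l)
  choose ℓ hℓ using fun l => exists_sum_smul_gen_eq (hmem l)
  have hunit : IsUnit (Matrix.of ℓ) := by
    rw [← Matrix.vecMul_injective_iff_isUnit]
    refine (injective_iff_map_eq_zero (Matrix.vecMulLinear (Matrix.of ℓ))).2 fun c hc => ?_
    have h0 : ∑ l, c l • gen b l = 0 := by
      apply e.injective
      rw [map_zero, map_sum]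
      simp only [map_smul, ← hℓ, Finset.smul_sum, smul_smul]
      rw [Finset.sum_comm]
      refine Finset.sum_eq_zero fun μ _ => ?_
      rw [← Finset.sum_smul, show ∑ l, c l * ℓ l μ = 0 from congrFun hc μ, zero_smul]
    exact funext (Fintype.linearIndependent_iff.1 (linearIndependent_gen b) c h0)
  let L : (Fin g → K) ≃ₗ[K] (Fin g → K) := LinearEquiv.ofInjectiveEndo
    (Matrix.mulVecLin (Matrix.of ℓ)) (Matrix.mulVec_injective_iff_isUnit.2 hunit)
  have hL : ∀ μ l, L.toLinearMap (Pi.single μ 1) l = ℓ l μ := fun μ l => by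
    change (Matrix.of ℓ).mulVec (Pi.single μ 1) l = _
    simp
  have hrel : ∑ μ, ∑ ν, b (L (Pi.single μ 1)) (L (Pi.single ν 1)) • (gen b' μ * gen b' ν) = 0 := by
    have h0 := sum_comp_smul_mul b L.toLinearMap (gen b')
    simp only [hL, hℓ] at h0
    refine h0.symm.trans ?_
    rw [← map_zero e, ← relation b]
    simp
  obtain ⟨t, ht⟩ := exists_eq_mul_comp hrel
  have ht' : ∀ v w, b (L v) (L w) = t * b' v w := fun v w => by
    have := LinearMap.ext_basis (Pi.basisFun K (Fin g)) (Pi.basisFun K (Fin g))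
      (B := b.compl₁₂ L.toLinearMap L.toLinearMap) (B' := t • b') fun μ ν => by
        simpa [comp] using ht μ ν
    exact congrFun (congrArg DFunLike.coe (congrFun (congrArg DFunLike.coe this) v)) w
  -- If $t=0$, the pullback of $b$ along the bijection $L$ vanishes, and so does $b$.
  have ht0 : t ≠ 0 := by
    rintro rfl
    let i : Fin g := ⟨0, by omega⟩
    refine apply_single_left_ne_zero hb (c := Pi.single i 1) (by simp) (funext fun μ => ?_)
    have := ht' (L.symm (Pi.single μ 1)) (L.symm (Pi.single i 1))
    simpa using this
  exact ⟨L, t⁻¹, inv_ne_zero ht0, fun v w => by rw [ht', inv_mul_cancel_left₀ ht0]⟩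

end QuadAlg

/-! ### The converse: projective syzygies and graded Nakayama. -/

section Homological

variable {A : Type u} [Ring A] {N : Type u} [AddCommGroup N] [Module A N] {g : ℕ}

theorem projective_ker_of_hasProjectiveDimensionLT (ε : A →ₗ[A] N) (hε : Function.Surjective ε)
    (d : (Fin g → A) →ₗ[A] A) (hd : LinearMap.range d = LinearMap.ker ε)
    (h : HasProjectiveDimensionLT (ModuleCat.of A N) 3) :
    Module.Projective A (LinearMap.ker d) := by
  let d' : (Fin g → A) →ₗ[A] LinearMap.ker ε := d.codRestrict _ fun v => hd ▸ ⟨v, rfl⟩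
  have hker : LinearMap.ker d' = LinearMap.ker d := LinearMap.ker_codRestrict _ _ _
  have hd' : Function.Surjective d' := by
    rintro ⟨a, ha⟩
    obtain ⟨v, rfl⟩ : a ∈ LinearMap.range d := hd ▸ ha
    exact ⟨v, rfl⟩
  rw [← hker]
  have p₁ : Projective (ModuleCat.of A A) := (IsProjective.iff_projective A).1 inferInstance
  have p₂ : Projective (ModuleCat.of A (Fin g → A)) :=
    (IsProjective.iff_projective (Fin g → A)).1 inferInstance
  have q : HasProjectiveDimensionLT (ModuleCat.of A (LinearMap.ker ε)) 2 :=
    (kernelComplex_shortExact ε hε).hasProjectiveDimensionLT_X₁ 2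
      (inferInstanceAs (HasProjectiveDimensionLT (ModuleCat.of A A) (1 + 1))) h
  have q' : HasProjectiveDimensionLT (ModuleCat.of A (LinearMap.ker d')) 1 :=
    (kernelComplex_shortExact d' hd').hasProjectiveDimensionLT_X₁ 1
      (inferInstanceAs (HasProjectiveDimensionLT (ModuleCat.of A (Fin g → A)) 1)) q
  exact (IsProjective.iff_projective _).2 (projective_iff_hasProjectiveDimensionLT_one.2 q')

end Homological

section Nakayama

variable {K : Type u} [Field K] {A : Type u} [Ring A] [Algebra K A]
  (𝒜 : ℕ → Submodule K A) [GradedAlgebra 𝒜]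

theorem proj_mul_of_mem {n m : ℕ} {a c : A} (ha : a ∈ 𝒜 n) : GradedAlgebra.proj 𝒜 m (a * c) =
    if n ≤ m then a * GradedAlgebra.proj 𝒜 (m - n) c else 0 :=
  DirectSum.coe_decompose_mul_of_left_mem 𝒜 m ha

theorem proj_mul_of_mem_right {n m : ℕ} {a c : A} (hc : c ∈ 𝒜 n) :
    GradedAlgebra.proj 𝒜 m (a * c) =
      if n ≤ m then GradedAlgebra.proj 𝒜 (m - n) a * c else 0 :=
  DirectSum.coe_decompose_mul_of_right_mem 𝒜 m hc

theorem proj_mul_eq_zero {p k : ℕ} {a c : A} (ha : ∀ i < p, GradedAlgebra.proj 𝒜 i a = 0)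
    (hc : ∀ i < k, GradedAlgebra.proj 𝒜 i c = 0) {m : ℕ} (hm : m < p + k) :
    GradedAlgebra.proj 𝒜 m (a * c) = 0 := by
  obtain ⟨N, hN⟩ := exists_eq_sum_proj 𝒜 a
  rw [hN N le_rfl, Finset.sum_mul, map_sum]
  refine Finset.sum_eq_zero fun i _ => ?_
  rw [proj_mul_of_mem 𝒜 (proj_mem 𝒜 i a)]
  split_ifs with him
  · by_cases hip : i < p
    · rw [ha i hip, zero_mul]
    · rw [hc _ (by omega), mul_zero]
  · rfl

variable {ι : Type*}

/-- The vectors of `A^ι` whose components of degree less than `k` vanish. -/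
def degreeFiltration (ι : Type*) (k : ℕ) : Submodule A (ι → A) where
  carrier := {v | ∀ i, ∀ m < k, GradedAlgebra.proj 𝒜 m (v i) = 0}
  zero_mem' i m _ := map_zero _
  add_mem' hv hw i m hm := by
    rw [Pi.add_apply, map_add, hv i m hm, hw i m hm, add_zero]
  smul_mem' a v hv i m hm := proj_mul_eq_zero 𝒜 (p := 0) (by simp) (hv i) (by omega)

variable {𝒜} in
theorem mem_of_forall_proj_mem [Fintype ι] {S : Submodule A (ι → A)} {v : ι → A}
    (h : ∀ n, (fun i => GradedAlgebra.proj 𝒜 n (v i)) ∈ S) : v ∈ S := by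
  choose N hN using fun i => exists_eq_sum_proj 𝒜 (v i)
  have : v = ∑ n ∈ Finset.range (Finset.univ.sup N), fun i => GradedAlgebra.proj 𝒜 n (v i) := by
    funext i
    rw [Finset.sum_apply]
    exact hN i _ (Finset.le_sup (Finset.mem_univ i))
  rw [this]
  exact sum_mem fun n _ => h n

variable {𝒜} [IsConnectedGraded 𝒜]

/-- A graded form of Nakayama's lemma. -/
theorem le_of_le_sup_smul [Fintype ι] {S T : Submodule A (ι → A)}
    (hT : ∀ v ∈ T, ∀ n, (fun i => GradedAlgebra.proj 𝒜 n (v i)) ∈ T)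
    (h : S ≤ T ⊔ RingHom.ker (augmentation 𝒜) • S) : S ≤ T := by
  -- Each use of the hypothesis multiplies the remainder by an element without constant term, which
  -- raises its order by one.
  have key : ∀ k, S ≤ T ⊔ degreeFiltration 𝒜 ι k := fun k => by
    induction k with
    | zero =>
      have : degreeFiltration 𝒜 ι 0 = ⊤ := eq_top_iff.2 fun v _ i m hm => absurd hm (by omega)
      rw [this, sup_top_eq]
      exact le_top
    | succ k ih =>
      refine h.trans (sup_le le_sup_left ?_)
      rw [Submodule.smul_le]
      intro a ha v hv
      obtain ⟨w, hw, r, hr, rfl⟩ := Submodule.mem_sup.1 (ih hv)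
      rw [smul_add]
      refine add_mem (Submodule.mem_sup_left (T.smul_mem a hw)) (Submodule.mem_sup_right ?_)
      refine fun i m hm => proj_mul_eq_zero 𝒜 (p := 1) (k := k) (fun j hj => ?_) (hr i) (by omega)
      obtain rfl : j = 0 := by omega
      exact augmentation_eq_zero_iff.1 ha
  intro v hv
  refine mem_of_forall_proj_mem (𝒜 := 𝒜) fun n => ?_
  -- A remainder of order $n+1$ does not affect the component of degree $n$. Only $T$ has to be
  -- graded, and no finite generation of $S$ is required.
  obtain ⟨w, hw, r, hr, rfl⟩ := Submodule.mem_sup.1 (key (n + 1) hv)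
  have : (fun i => GradedAlgebra.proj 𝒜 n ((w + r) i)) =
      fun i => GradedAlgebra.proj 𝒜 n (w i) := by
    funext i
    rw [Pi.add_apply, map_add, hr i n (Nat.lt_succ_self n), add_zero]
  rw [this]
  exact hT w hw n

end Nakayama

/-! ### A single linear generator for the syzygies. -/

section Generator

variable {K : Type u} [Field K] {A : Type u} [Ring A] [Algebra K A]
  {𝒜 : ℕ → Submodule K A} [GradedAlgebra 𝒜] {g : ℕ} {x : Fin g → A}

theorem proj_mem_ker_linearCombination (hx1 : ∀ i, x i ∈ 𝒜 1) {v : Fin g → A}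
    (hv : v ∈ LinearMap.ker (Fintype.linearCombination A x)) (n : ℕ) :
    (fun i => GradedAlgebra.proj 𝒜 n (v i)) ∈ LinearMap.ker (Fintype.linearCombination A x) := by
  rw [LinearMap.mem_ker, Fintype.linearCombination_apply] at hv ⊢
  have := congrArg (GradedAlgebra.proj 𝒜 (n + 1)) hv
  simpa only [map_sum, smul_eq_mul, proj_succ_mul 𝒜 (hx1 _), map_zero] using this

variable [IsConnectedGraded 𝒜]

theorem augmentation_eq_zero_of_mem_ker (hx1 : ∀ i, x i ∈ 𝒜 1) (hli : LinearIndependent K x)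
    {v : Fin g → A} (hv : v ∈ LinearMap.ker (Fintype.linearCombination A x)) (i : Fin g) :
    augmentation 𝒜 (v i) = 0 := by
  have := proj_mem_ker_linearCombination hx1 hv 0
  rw [LinearMap.mem_ker, Fintype.linearCombination_apply] at this
  simp only [← algebraMap_augmentation, smul_eq_mul, ← Algebra.smul_def] at this
  exact Fintype.linearIndependent_iff.1 hli _ this i

/-- A projective graded submodule `Ω` of `A₊^g` with `Hom(Ω, A) / Hom(A^g, A) ≅ K` is generated
by a vector of linear forms which span `A₁`. -/
theorem exists_generator_of_projective (hg : 𝒜 1 = ⊥ → g = 0) {Ω : Submodule A (Fin g → A)}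
    (hΩ : ∀ v ∈ Ω, ∀ n, (fun i => GradedAlgebra.proj 𝒜 n (v i)) ∈ Ω)
    (hΩ0 : ∀ v ∈ Ω, ∀ i, augmentation 𝒜 (v i) = 0) (hproj : Module.Projective A Ω)
    (θ : (Ω →ₗ[A] A) →+ K) (hθ : Function.Surjective θ)
    (hθ0 : ∀ φ, θ φ = 0 ↔ ∃ ψ : (Fin g → A) →ₗ[A] A, φ = ψ ∘ₗ Ω.subtype)
    (hθa : ∀ φ a, θ (LinearMap.toSpanSingleton A A a ∘ₗ φ) = θ φ * augmentation 𝒜 a) :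
    ∃ f ∈ Ω, f ≠ 0 ∧ (∀ i, f i ∈ 𝒜 1) ∧ (∀ v ∈ Ω, ∃ t : A, v = t • f) ∧
      𝒜 1 ≤ Submodule.span K (Set.range f) := by
  obtain ⟨φ₀, hφ₀⟩ := hθ 1
  have hrestr : ∀ (ψ : (Fin g → A) →ₗ[A] A) (v : Fin g → A), v ∈ Ω → augmentation 𝒜 (ψ v) = 0 := by
    intro ψ v hv
    rw [linearMap_pi_apply, map_sum]
    exact Finset.sum_eq_zero fun i _ => by
      rw [map_mul, hΩ0 v hv, zero_mul]
  -- The difference $\varphi-\varphi_0\,\theta(\varphi)$ has class zero, so it is a restriction from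
  -- $A^g$ and takes values in $A_+$ on $\Omega$.
  have hφ : ∀ (φ : Ω →ₗ[A] A) ω, augmentation 𝒜 (φ ω) = augmentation 𝒜 (φ₀ ω) * θ φ := by
    intro φ ω
    have h0 : θ (φ - LinearMap.toSpanSingleton A A (algebraMap K A (θ φ)) ∘ₗ φ₀) = 0 := by
      rw [map_sub, hθa, hφ₀, augmentation_algebraMap, one_mul, sub_self]
    obtain ⟨ψ, hψ⟩ := (hθ0 _).1 h0
    have := hrestr ψ ω ω.2
    rw [show ψ ω = _ from (congrArg (fun F : Ω →ₗ[A] A => F ω) hψ).symm, LinearMap.sub_apply,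
      map_sub, LinearMap.comp_apply, LinearMap.toSpanSingleton_apply, smul_eq_mul, map_mul,
      augmentation_algebraMap] at this
    exact sub_eq_zero.1 this
  -- The section `s` of the free cover supplies a dual basis. By `hφ`, all coordinates of such an
  -- $\omega$ lie in $A_+$.
  have hdual : ∀ ω : Ω, augmentation 𝒜 (φ₀ ω) = 0 →
      (ω : Fin g → A) ∈ RingHom.ker (augmentation 𝒜) • Ω := by
    intro ω hω
    obtain ⟨s, hs⟩ := Module.projective_def'.1 hproj
    have hsum : ω = (s ω).sum fun p a => a • p := (LinearMap.congr_fun hs ω).symm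
    have hsum' : (ω : Fin g → A) = ∑ p ∈ (s ω).support, s ω p • (p : Fin g → A) := by
      conv_lhs => rw [hsum]
      simp [Finsupp.sum]
    rw [hsum']
    refine sum_mem fun p _ => Submodule.smul_mem_smul ?_ p.2
    change augmentation 𝒜 ((Finsupp.lapply p ∘ₗ s) ω) = 0
    rw [hφ, hω, zero_mul]
  -- Serves to find a homogeneous generator: if every homogeneous element of $\Omega$ were in $Z$,
  -- all of $\Omega$ would be.
  let Z : Submodule A (Fin g → A) :=
    { carrier := {v | ∃ h : v ∈ Ω, augmentation 𝒜 (φ₀ ⟨v, h⟩) = 0}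
      zero_mem' := ⟨zero_mem _, (congrArg _ (map_zero φ₀)).trans (map_zero _)⟩
      add_mem' := by
        rintro v w ⟨hv, hv'⟩ ⟨hw, hw'⟩
        refine ⟨add_mem hv hw, (congrArg _ (map_add φ₀ ⟨v, hv⟩ ⟨w, hw⟩)).trans ?_⟩
        rw [map_add, hv', hw', add_zero]
      smul_mem' := by
        rintro a v ⟨hv, hv'⟩
        refine ⟨Ω.smul_mem a hv, (congrArg _ (map_smul φ₀ a ⟨v, hv⟩)).trans ?_⟩
        rw [smul_eq_mul, map_mul, hv', mul_zero] }
  -- Otherwise $\Omega=A_+\Omega$, so $\Omega=0$ by Nakayama, contradicting $\theta(\varphi_0)=1$.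
  have hne : ∃ ω : Ω, augmentation 𝒜 (φ₀ ω) ≠ 0 := by
    by_contra! hall
    have hbot : Ω ≤ ⊥ := by
      refine le_of_le_sup_smul (𝒜 := 𝒜) (fun v hv n => ?_) fun v hv =>
        Submodule.mem_sup_right (hdual ⟨v, hv⟩ (hall _))
      rw [(Submodule.mem_bot A).1 hv]
      simp only [Pi.zero_apply, map_zero]
      exact zero_mem _
    have : φ₀ = 0 := LinearMap.ext fun ω => by
      rw [show ω = 0 from Subtype.ext ((Submodule.mem_bot A).1 (hbot ω.2)), map_zero, map_zero]
    rw [this, map_zero] at hφ₀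
    exact zero_ne_one hφ₀
  obtain ⟨n, f, hf, hfn, hκ⟩ : ∃ n, ∃ f, ∃ hf : f ∈ Ω, (∀ i, f i ∈ 𝒜 n) ∧
      augmentation 𝒜 (φ₀ ⟨f, hf⟩) ≠ 0 := by
    obtain ⟨ω, hω⟩ := hne
    by_contra! hall
    obtain ⟨h, h'⟩ : (ω : Fin g → A) ∈ Z := mem_of_forall_proj_mem (𝒜 := 𝒜) fun n =>
      ⟨hΩ ω ω.2 n, hall n _ _ fun i => proj_mem 𝒜 n _⟩
    exact hω h'
  have hf0 : f ≠ 0 := by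
    rintro rfl
    exact hκ ((congrArg _ (map_zero φ₀)).trans (map_zero _))
  have hspan : Ω ≤ Submodule.span A {f} := by
    refine le_of_le_sup_smul (𝒜 := 𝒜) (fun v hv m => ?_) fun v hv => ?_
    · obtain ⟨t, rfl⟩ := Submodule.mem_span_singleton.1 hv
      simp only [Pi.smul_apply, smul_eq_mul, proj_mul_of_mem_right 𝒜 (hfn _)]
      split_ifs
      · exact Submodule.mem_span_singleton.2 ⟨_, rfl⟩
      · exact zero_mem _
    · let a := algebraMap K A (augmentation 𝒜 (φ₀ ⟨v, hv⟩) / augmentation 𝒜 (φ₀ ⟨f, hf⟩))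
      have h := hdual (⟨v, hv⟩ - a • ⟨f, hf⟩) (by
        rw [map_sub, map_smul, map_sub, smul_eq_mul, map_mul, augmentation_algebraMap,
          div_mul_cancel₀ _ hκ, sub_self])
      refine Submodule.mem_sup.2 ⟨a • f, Submodule.mem_span_singleton.2 ⟨a, rfl⟩, _, h, ?_⟩
      simp
  -- The class of $\varphi_0a$ is zero, so $\varphi_0a$ extends to $A^g$. Evaluate at $f$, take
  -- degree one, and divide by the nonzero scalar part of $\varphi_0(f)$.
  have hlin : ∀ a ∈ 𝒜 1, ∃ w : Fin g → A,
      a = ∑ i, GradedAlgebra.proj 𝒜 1 (f i * w i) := by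
    intro a ha
    have h0 : θ (LinearMap.toSpanSingleton A A a ∘ₗ φ₀) = 0 := by
      rw [hθa, augmentation_of_mem_one ha, mul_zero]
    obtain ⟨ψ, hψ⟩ := (hθ0 _).1 h0
    have h1 : φ₀ ⟨f, hf⟩ * a = ∑ i, f i * ψ (Pi.single i 1) := by
      rw [← linearMap_pi_apply]
      exact congrArg (fun F : Ω →ₗ[A] A => F ⟨f, hf⟩) hψ
    have h2 := congrArg (GradedAlgebra.proj 𝒜 1) h1
    rw [proj_succ_mul 𝒜 ha 0, ← algebraMap_augmentation, ← Algebra.smul_def, map_sum] at h2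
    refine ⟨fun i => (augmentation 𝒜 (φ₀ ⟨f, hf⟩))⁻¹ • ψ (Pi.single i 1), ?_⟩
    simp only [mul_smul_comm, map_smul, ← Finset.smul_sum]
    rw [← h2, inv_smul_smul₀ hκ]
  -- Degree 0 is excluded because the entries of $f$ lie in $A_+$. In degree above 1, `hlin` would
  -- give $A_1=0$, hence $g=0$ and $f=0$.
  have hn : n = 1 := by
    rcases Nat.lt_trichotomy n 1 with h | h | h
    · obtain rfl : n = 0 := by omega
      refine absurd (funext fun i => ?_) hf0
      rw [← proj_of_mem 𝒜 (hfn i), Pi.zero_apply]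
      exact augmentation_eq_zero_iff.1 (hΩ0 f hf i)
    · exact h
    · have h1 : 𝒜 1 = ⊥ := (Submodule.eq_bot_iff _).2 fun a ha => by
        obtain ⟨w, rfl⟩ := hlin a ha
        refine Finset.sum_eq_zero fun j _ => ?_
        rw [proj_mul_of_mem 𝒜 (hfn j), if_neg (by omega)]
      have := hg h1
      subst this
      exact absurd (Subsingleton.elim f 0) hf0
  subst hn
  refine ⟨f, hf, hf0, hfn, fun v hv => ?_, fun a ha => ?_⟩
  · obtain ⟨t, ht⟩ := Submodule.mem_span_singleton.1 (hspan hv)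
    exact ⟨t, ht.symm⟩
  · obtain ⟨w, rfl⟩ := hlin a ha
    refine sum_mem fun i _ => ?_
    rw [proj_mul_of_mem 𝒜 (hfn i), if_pos le_rfl, Nat.sub_self, ← algebraMap_augmentation,
      ← Algebra.commutes, ← Algebra.smul_def]
    exact Submodule.smul_mem _ _ (Submodule.subset_span ⟨i, rfl⟩)

end Generator

/-! ### Recognising the quadratic algebra from its syzygies. -/

section Recognition

variable {K : Type u} [Field K] {A : Type u} [Ring A] [Algebra K A]
  {𝒜 : ℕ → Submodule K A} [GradedAlgebra 𝒜] {g : ℕ}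

theorem map_proj_of_map_le {B : Type u} [Ring B] [Algebra K B] {ℬ : ℕ → Submodule K B}
    [GradedAlgebra ℬ] (f : A →ₗ[K] B) (hf : ∀ n, (𝒜 n).map f ≤ ℬ n) (n : ℕ) (a : A) :
    f (GradedAlgebra.proj 𝒜 n a) = GradedAlgebra.proj ℬ n (f a) := by
  have hmem : ∀ i c, c ∈ 𝒜 i → f c ∈ ℬ i := fun i c hc => hf i ⟨c, hc, rfl⟩
  obtain ⟨N, hN⟩ := exists_eq_sum_proj 𝒜 a
  have key : ∀ i c, c ∈ 𝒜 i → f (GradedAlgebra.proj 𝒜 n c) = GradedAlgebra.proj ℬ n (f c) :=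
    fun i c hc => by
      by_cases h : i = n
      · subst h
        exact (congrArg f (proj_of_mem 𝒜 hc)).trans (proj_of_mem ℬ (hmem _ c hc)).symm
      · exact (congrArg f (proj_of_mem_ne 𝒜 hc h)).trans
          ((map_zero f).trans (proj_of_mem_ne ℬ (hmem i c hc) h).symm)
  rw [hN N le_rfl]
  simp only [map_sum]
  exact Finset.sum_congr rfl fun i _ => key i _ (proj_mem 𝒜 i a)

/-- Injectivity of $\Phi:\mathcal A(b)\to A$ goes by degree. If $\sum v_\nu x^\nu$ is in the kernel,
then $(\Phi v_\nu)$ is a multiple $tf$; lifting $t$ and using injectivity one degree lower, $v$ is a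
multiple of `leftPart`, so the element is already zero in $\mathcal A(b)$. -/
theorem gradedIso_of_generator [IsConnectedGraded 𝒜] {x : Fin g → A} (hx1 : ∀ i, x i ∈ 𝒜 1)
    (hx : Algebra.adjoin K (Set.range x) = ⊤) (b : LinearMap.BilinForm K (Fin g → K))
    (hrel : ∑ ν, (∑ μ, QuadAlg.comp b μ ν • x μ) * x ν = 0)
    (hgen : ∀ v : Fin g → A, ∑ ν, v ν * x ν = 0 →
      ∃ t, ∀ ν, v ν = t * ∑ μ, QuadAlg.comp b μ ν • x μ) :
    GradedIso 𝒜 (QuadAlg.grading b) := by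
  let Φ : QuadAlg b →ₐ[K] A := QuadAlg.liftHom b x (by
    rw [← hrel, Finset.sum_comm]
    simp only [Finset.sum_mul, smul_mul_assoc])
  have hΦ : ∀ μ, Φ (QuadAlg.gen b μ) = x μ := QuadAlg.liftHom_gen b _ _
  have hsurj : Function.Surjective Φ := by
    rw [← AlgHom.range_eq_top, eq_top_iff, ← hx, Algebra.adjoin_le_iff]
    rintro _ ⟨μ, rfl⟩
    exact ⟨_, hΦ μ⟩
  have hpow : ∀ n a, a ∈ 𝒜 1 ^ n → a ∈ 𝒜 n := fun n a ha => by
    induction ha using Submodule.pow_induction_on_left' with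
    | algebraMap r => exact SetLike.algebraMap_mem_graded 𝒜 r
    | add x y i hx hy ihx ihy => exact add_mem ihx ihy
    | mem_mul m hm i x hx ih => rw [Nat.succ_eq_one_add]; exact SetLike.mul_mem_graded hm ih
  have hmap : ∀ n, (QuadAlg.grading b n).map Φ.toLinearMap ≤ 𝒜 n := fun n => by
    change (Submodule.span K (Set.range (QuadAlg.gen b)) ^ n).map Φ.toLinearMap ≤ _
    rw [Submodule.map_pow]
    refine le_trans (pow_le_pow_left' ?_ n) (hpow n)
    rw [Submodule.map_span_le]
    rintro _ ⟨l, rfl⟩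
    exact (hΦ l).symm ▸ hx1 l
  have hproj : ∀ n a, Φ (GradedAlgebra.proj (QuadAlg.grading b) n a) =
      GradedAlgebra.proj 𝒜 n (Φ a) := map_proj_of_map_le Φ.toLinearMap hmap
  have hlift : ∀ n a, a ∈ 𝒜 n → ∃ c ∈ QuadAlg.grading b n, Φ c = a := fun n a ha => by
    obtain ⟨c, rfl⟩ := hsurj a
    exact ⟨_, proj_mem _ n c, by rw [hproj, proj_of_mem 𝒜 ha]⟩
  have hmem : ∀ n c, c ∈ QuadAlg.grading b n → Φ c ∈ 𝒜 n := fun n c hc => hmap n ⟨c, hc, rfl⟩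
  have hpart : ∀ ν, Φ (QuadAlg.leftPart b ν) = ∑ μ, QuadAlg.comp b μ ν • x μ := fun ν => by
    simp [QuadAlg.leftPart, hΦ]
  have hker : ∀ n c, c ∈ QuadAlg.grading b n → Φ c = 0 → c = 0 := fun n => by
    induction n with
    | zero =>
      intro c hc h
      rw [← proj_of_mem (QuadAlg.grading b) hc, ← algebraMap_augmentation] at h ⊢
      rw [AlgHom.commutes, map_eq_zero_iff _ (algebraMap_injective 𝒜)] at h
      rw [h, map_zero]
    | succ n ih =>
      intro c hc h
      obtain ⟨v, hv, rfl⟩ := exists_eq_sum_mul_of_mem_succ (QuadAlg.gen_mem b)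
        (QuadAlg.adjoin_gen b) hc
      simp only [map_sum, map_mul, hΦ] at h
      obtain ⟨t, ht⟩ := hgen _ h
      have hy : ∀ ν, ∑ μ, QuadAlg.comp b μ ν • x μ ∈ 𝒜 1 := fun ν =>
        sum_mem fun μ _ => Submodule.smul_mem _ _ (hx1 μ)
      cases n with
      | zero =>
        -- The coefficients $v_\nu$ are scalars here, whereas $t f_\nu$ has no component of degree
        -- 0; so they vanish.
        refine Finset.sum_eq_zero fun ν _ => ?_
        rw [ih (v ν) (hv ν), zero_mul]
        rw [← proj_of_mem 𝒜 (hmem 0 _ (hv ν)), ht, proj_zero_mul 𝒜 (hy ν)]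
      | succ m =>
        obtain ⟨t', ht'm, ht'⟩ := hlift m _ (proj_mem 𝒜 m t)
        have hv' : ∀ ν, v ν = t' * QuadAlg.leftPart b ν := fun ν => by
          refine sub_eq_zero.1 (ih _ (sub_mem (hv ν)
            (SetLike.mul_mem_graded ht'm (QuadAlg.leftPart_mem ν))) ?_)
          rw [map_sub, map_mul, hpart, ht', ← proj_succ_mul 𝒜 (hy ν), ← ht,
            proj_of_mem 𝒜 (hmem _ _ (hv ν)), sub_self]
        simp only [hv', mul_assoc, ← Finset.mul_sum, QuadAlg.sum_leftPart_mul, mul_zero]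
  have hinj : Function.Injective Φ := by
    rw [injective_iff_map_eq_zero]
    intro c hc
    refine eq_zero_of_proj_eq_zero (QuadAlg.grading b) fun n => hker n _ (proj_mem _ n c) ?_
    rw [hproj, hc, map_zero]
  let e := AlgEquiv.ofBijective Φ ⟨hinj, hsurj⟩
  have he : ∀ c, e.symm (Φ c) = c := e.symm_apply_apply
  refine ⟨e.symm, fun n => le_antisymm ?_ fun c hc => ⟨Φ c, hmem n c hc, he c⟩⟩
  rintro _ ⟨a, ha, rfl⟩
  obtain ⟨c, hc, rfl⟩ := hlift n a ha
  exact (he c).symm ▸ hc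

end Recognition

/-- The $g$ vectors $f_\nu$ span a space of dimension $g$, so they are independent and their
coefficient matrix is invertible. -/
theorem exists_nondegenerate_of_span_le {K V : Type*} [Field K] [AddCommGroup V] [Module K V]
    {g : ℕ} {x f : Fin g → V} (hx : LinearIndependent K x)
    (hf : ∀ i, f i ∈ Submodule.span K (Set.range x))
    (hxf : Submodule.span K (Set.range x) ≤ Submodule.span K (Set.range f)) :
    ∃ b : LinearMap.BilinForm K (Fin g → K), b.Nondegenerate ∧
      ∀ ν, f ν = ∑ μ, b (Pi.single μ 1) (Pi.single ν 1) • x μ := by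
  choose β hβ using fun ν => (Submodule.mem_span_range_iff_exists_fun K).1 (hf ν)
  have hfi : LinearIndependent K f := by
    rw [linearIndependent_iff_card_le_finrank_span, Fintype.card_fin]
    have := finrank_span_eq_card hx
    rw [Fintype.card_fin] at this
    refine this.symm.le.trans ?_
    have : Module.Finite K (Submodule.span K (Set.range f)) :=
      Module.Finite.span_of_finite K (Set.finite_range f)
    exact Submodule.finrank_mono hxf
  let M : Matrix (Fin g) (Fin g) K := Matrix.of fun μ ν => β ν μ
  have hM : M.det ≠ 0 := by
    rw [← isUnit_iff_ne_zero, ← Matrix.isUnit_iff_isUnit_det, ← Matrix.mulVec_injective_iff_isUnit]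
    refine (injective_iff_map_eq_zero M.mulVecLin).2 fun c hc => ?_
    refine funext (Fintype.linearIndependent_iff.1 hfi c ?_)
    simp only [← hβ, Finset.smul_sum, smul_smul]
    rw [Finset.sum_comm]
    refine Finset.sum_eq_zero fun μ _ => ?_
    rw [← Finset.sum_smul]
    have : ∑ ν, c ν * β ν μ = 0 := by
      rw [← show M.mulVec c μ = 0 from congrFun hc μ]
      exact Finset.sum_congr rfl fun _ _ => mul_comm _ _
    rw [this, zero_smul]
  refine ⟨Matrix.toBilin' M, (Matrix.nondegenerate_of_det_ne_zero hM).toBilin', fun ν => ?_⟩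
  simp [Matrix.toBilin'_single, M, hβ]

/-- Right multiplication by $y$ factors through $N$. The resulting homomorphism $N\to A$ is zero,
and its value at $\varepsilon(1)$ is $y$. -/
theorem eq_zero_of_ker_le_ker {A : Type u} [Ring A] {N : Type u} [AddCommGroup N] [Module A N]
    {ε : A →ₗ[A] N} (hε : Function.Surjective ε)
    (h : Subsingleton (Ext (ModuleCat.of A N) (ModuleCat.of A A) 0)) {y : A}
    (hker : LinearMap.ker ε ≤ LinearMap.ker (LinearMap.toSpanSingleton A A y)) : y = 0 := by
  have hs := linearMap_eq_zero_of_subsingleton_ext_zero h ((LinearMap.ker ε).liftQ _ hker ∘ₗ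
    (ε.quotKerEquivOfSurjective hε).symm.toLinearMap)
  have h1 := LinearMap.congr_fun hs (ε 1)
  have h2 : (ε.quotKerEquivOfSurjective hε).symm (ε 1) = (LinearMap.ker ε).mkQ 1 := by
    rw [LinearEquiv.symm_apply_eq]; rfl
  rw [LinearMap.comp_apply, LinearEquiv.coe_coe, h2] at h1
  simpa using h1

theorem exists_gradedIso_of_isRegularOfDim_two {K : Type u} [Field K] {A : Type u} [Ring A]
    [Algebra K A] (𝒜 : ℕ → Submodule K A) [GradedAlgebra 𝒜] (h : IsRegularOfDim 𝒜 2) :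
    ∃ (g : ℕ) (b : LinearMap.BilinForm K (Fin g → K)), 2 ≤ g ∧ b.Nondegenerate ∧
      GradedIso 𝒜 (QuadAlg.grading b) := by
  have := h.grAlg.connected
  have := h.grAlg.finite_degree_one
  let bs := Module.finBasis K (𝒜 1)
  set g := Module.finrank K (𝒜 1)
  let x : Fin g → A := fun i => bs i
  have hx1 : ∀ i, x i ∈ 𝒜 1 := fun i => (bs i).2
  have hli : LinearIndependent K x :=
    bs.linearIndependent.map' (𝒜 1).subtype (Submodule.ker_subtype _)
  have hspan : Submodule.span K (Set.range x) = 𝒜 1 := by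
    have : Set.range x = (𝒜 1).subtype '' Set.range bs := by
      rw [← Set.range_comp]; rfl
    rw [this, Submodule.span_image, bs.span_eq, Submodule.map_subtype_top]
  have hx := adjoin_range_eq_top hspan h.grAlg.generated
  have hε := isAugmentation_augmentationHom 𝒜
  generalize (augmentationHom 𝒜).hom = ε at hε
  have hd := hε.range_linearCombination_eq_ker hx1 hx
  have hpd : HasProjectiveDimensionLT (trivialModule 𝒜) 3 := by
    refine (projectiveDimension_le_iff _ 2).1 ?_
    exact (le_iSup (fun M : ModuleCat.{u} A => projectiveDimension M) (trivialModule 𝒜)).trans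
      h.globalDimension_eq.le
  obtain ⟨δ, hδ, hδ0, hδa⟩ := exists_ext_two_presentation ε hε.surjective _ hd
  obtain ⟨e, he⟩ := h.gorenstein.ext_top
  obtain ⟨f, hf, hf0, hf1, hgen, hfs⟩ := exists_generator_of_projective (𝒜 := 𝒜)
    (fun h0 => by
      change Module.finrank K (𝒜 1) = 0
      rw [h0, finrank_bot])
    (fun v hv => proj_mem_ker_linearCombination hx1 hv)
    (fun v hv => augmentation_eq_zero_of_mem_ker hx1 hli hv)
    (projective_ker_of_hasProjectiveDimensionLT ε hε.surjective _ hd hpd)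
    (e.toAddMonoidHom.comp δ) (e.surjective.comp hδ)
    (fun φ => (map_eq_zero_iff e e.injective).trans (hδ0 φ))
    (fun φ a => (congrArg e (hδa φ a)).trans (he _ _))
  have hrel : ∑ ν, f ν * x ν = 0 := hf
  obtain ⟨b, hb, hfb⟩ := exists_nondegenerate_of_span_le hli (fun i => hspan ▸ hf1 i)
    (hspan.trans_le hfs)
  refine ⟨g, b, ?_, hb, gradedIso_of_generator hx1 hx b ?_ fun v hv => ?_⟩
  -- As $f\ne 0$ has a nonzero entry, $g=1$. Then $x$ is a multiple of $f$, so $x^2=0$; right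
  -- multiplication by $x$ kills $A_+=Ax$, and $\mathrm{Ext}^0(K,A)=0$ forces $x=0$.
  · by_contra hg
    obtain ⟨i, hi⟩ := Function.ne_iff.1 hf0
    have huniv : ∀ j : Fin g, j = i := fun j => Fin.ext (by omega)
    have hxx : x i * x i = 0 := by
      obtain ⟨c, hc⟩ := (Submodule.mem_span_range_iff_exists_fun K).1 (hfs (hx1 i))
      rw [Fintype.sum_eq_single i fun j hj => absurd (huniv j) hj] at hc hrel
      conv_lhs => rw [← hc]
      rw [smul_mul_assoc, hc, hrel, smul_zero]
    have hker : LinearMap.ker ε ≤ LinearMap.ker (LinearMap.toSpanSingleton A A (x i)) := by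
      rw [← hd]
      rintro _ ⟨v, rfl⟩
      rw [LinearMap.mem_ker, LinearMap.toSpanSingleton_apply, Fintype.linearCombination_apply,
        Fintype.sum_eq_single i fun j hj => absurd (huniv j) hj, smul_eq_mul, smul_eq_mul,
        mul_assoc, hxx, mul_zero]
    exact hli.ne_zero i (eq_zero_of_ker_le_ker (N := trivialModule 𝒜) hε.surjective
      (h.gorenstein.ext_eq_zero 0 (by norm_num)) hker)
  · simpa only [QuadAlg.comp, ← hfb] using hrel
  · obtain ⟨t, rfl⟩ := hgen v hv
    exact ⟨t, fun ν => by simp only [QuadAlg.comp, ← hfb]; rfl⟩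

end

theorem theorem2p1 {K : Type u} [Field K] :
    -- the algebra of a nondegenerate bilinear form is regular of global dimension 2
    (∀ (g : ℕ) (b : LinearMap.BilinForm K (Fin g → K)), 2 ≤ g → b.Nondegenerate →
      IsRegularOfDim (QuadAlg.grading b) 2) ∧
    -- every regular algebra of global dimension 2 arises in this way
    (∀ (A : Type u) [Ring A] [Algebra K A] (𝒜 : ℕ → Submodule K A) [GradedAlgebra 𝒜],
      IsRegularOfDim 𝒜 2 →
      ∃ (g : ℕ) (b : LinearMap.BilinForm K (Fin g → K)), 2 ≤ g ∧ b.Nondegenerate ∧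
        GradedIso 𝒜 (QuadAlg.grading b)) ∧
    -- classification up to isomorphism
    (∀ (g g' : ℕ) (b : LinearMap.BilinForm K (Fin g → K))
      (b' : LinearMap.BilinForm K (Fin g' → K)),
      2 ≤ g → 2 ≤ g' → b.Nondegenerate → b'.Nondegenerate →
      (GradedIso (QuadAlg.grading b) (QuadAlg.grading b') ↔
        ∃ (h : g = g') (L : (Fin g → K) ≃ₗ[K] (Fin g → K)) (c : K), c ≠ 0 ∧
          ∀ v w : Fin g → K,
            b' (v ∘ Fin.cast h.symm) (w ∘ Fin.cast h.symm) = c * b (L v) (L w)) ∧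
      -- the scalar can be dropped when every scalar is a square, e.g. over algebraically closed K
      ((∀ c : K, IsSquare c) →
        (GradedIso (QuadAlg.grading b) (QuadAlg.grading b') ↔
          ∃ (h : g = g') (L : (Fin g → K) ≃ₗ[K] (Fin g → K)),
            ∀ v w : Fin g → K,
              b' (v ∘ Fin.cast h.symm) (w ∘ Fin.cast h.symm) = b (L v) (L w)))) := by

  refine ⟨fun g b hg hb => QuadAlg.isRegularOfDim_two hg hb,
    fun A _ _ 𝒜 _ h => exists_gradedIso_of_isRegularOfDim_two 𝒜 h,
    fun g g' b b' hg _ hb _ => ?_⟩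
  have main : GradedIso (QuadAlg.grading b) (QuadAlg.grading b') ↔
      ∃ (h : g = g') (L : (Fin g → K) ≃ₗ[K] (Fin g → K)) (c : K), c ≠ 0 ∧
        ∀ v w : Fin g → K,
          b' (v ∘ Fin.cast h.symm) (w ∘ Fin.cast h.symm) = c * b (L v) (L w) := by
    constructor
    · intro hiso
      obtain rfl := QuadAlg.eq_of_gradedIso hiso
      exact ⟨rfl, QuadAlg.exists_equiv_of_gradedIso hg hb hiso⟩
    · rintro ⟨rfl, L, c, hc, h⟩
      exact QuadAlg.gradedIso_of_equiv L hc h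
  refine ⟨main, fun hsq => main.trans ⟨?_, ?_⟩⟩
  · rintro ⟨rfl, L, c, hc, h⟩
    -- A square root $s$ of $c$ is absorbed into $L$: $s^2\,b(Lv,Lw)=b(sLv,sLw)$.
    obtain ⟨s, rfl⟩ := hsq c
    have hs : s ≠ 0 := left_ne_zero_of_mul hc
    refine ⟨rfl, L.trans (LinearEquiv.smulOfNeZero K _ s hs), fun v w => (h v w).trans ?_⟩
    simp [mul_assoc]
  · rintro ⟨rfl, L, h⟩
    exact ⟨rfl, L, 1, one_ne_zero, fun v w => (h v w).trans (one_mul _).symm⟩
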